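/- Let $X$ and $Y$ be real random variables that are almost surely bounded and have continuous distribution functions. Write $\mu_Y(x)=E(Y\mid X=x)$, $\nu_Y^2(x)=\mathrm{var}(Y\mid X=x)$, $\mu_X(y)=E(X\mid Y=y)$, $\nu_X^2(y)=\mathrm{var}(X\mid Y=y)$, where $\nu_Y,\nu_X\ge 0$. Assume that there are constants $b,C>0$ and versions of these functions such that, almost everywhere (with respect to the law of $X$ for $\mu_Y,\nu_Y$ and to the law of $Y$ for $\mu_X,\nu_X$): 1. $\nu_Y^2(x)>b^{-2}$ and $\nu_X^2(y)>b^{-2}$; 2. $\mu_Y,\nu_Y^2,\mu_X,\nu_X^2$ have continuous derivatives (each is differentiable at all points of some set of full measure, and its derivative is continuous on that set); 3. $\max\{|\mu_Y'(x)|,|\nu_Y'(x)|\}\le C\,\nu_Y(x)$ and $\max\{|\mu_X'(y)|,|\nu_X'(y)|\}\le C\,\nu_X(y)$. Define $$G^2_{Y\mid X}=1-\exp\bigl[E\{\log \mathrm{var}(Y\mid X)\}-\log \mathrm{var}(Y)\bigr],\qquad G^2=\max(G^2_{Y\mid X},G^2_{X\mid Y}).$$ Let $(x_1,y_1),(x_2,y_2),\dots$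 be independent observations with the law of $(X,Y)$. For each $n$, arrange the first $n$ observations in increasing order of $x$. A slicing scheme $S$ divides them into $|S|$ consecutive slices of sizes $n_1,\dots,n_{|S|}\ge 1$, and $m_S=\min_h n_h$. Let $m=\lceil n^{1/2}\rceil$, let $\widehat\nu^2=n^{-1}\sum_i (y_i-\bar y)^2$, and for a slice $h$ of $S$ let $\widehat\sigma_h^2=n_h^{-1}\min_{\alpha,\beta}\sum_{i\in h}(y_i-\alpha-\beta x_i)^2$. For $\lambda_0>0$ put $$\log \mathrm{LR}_S=\frac n2\log\widehat\nu^2-\sum_{h=1}^{|S|}\frac{n_h}{2}\log\widehat\sigma_h^2,\qquad nD(Y\mid S,\lambda_0)=2\log \mathrm{LR}_S-\lambda_0(|S|-1)\log n,$$ $$G_m^2(Y\mid X,\lambda_0)=1-\exp\Bigl\{-\max_{S:\,m_S\ge m}D(Y\mid S,\lambda_0)\Bigr\},$$ $$\mathrm{BF}^*(\lambda_0)=\Bigl\{\sum_{S:\,m_S\ge m}n^{-\lambda_0(|S|-1)/2}\Bigr\}^{-1}\sum_{S:\,m_S\ge m}\exp\Bigl\{\frac n2D(Y\mid S,\lambda_0)\Bigr\},\qquad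 G_t^2(Y\mid X,\lambda_0)=1-\mathrm{BF}^*(\lambda_0)^{-2/n}.$$ Define $G_m^2(X\mid Y,\lambda_0)$ and $G_t^2(X\mid Y,\lambda_0)$ by exchanging the roles of $x$ and $y$, and let $G_m^2(\lambda_0)=\max\{G_m^2(Y\mid X,\lambda_0),G_m^2(X\mid Y,\lambda_0)\}$ and $G_t^2(\lambda_0)=\max\{G_t^2(Y\mid X,\lambda_0),G_t^2(X\mid Y,\lambda_0)\}$. Then for every $\lambda_0>0$, almost surely as $n\to\infty$, $$G_m^2(Y\mid X,\lambda_0)\to G^2_{Y\mid X},\qquad G_t^2(Y\mid X,\lambda_0)\to G^2_{Y\mid X},$$ $$G_m^2(\lambda_0)\to G^2,\qquad G_t^2(\lambda_0)\to G^2 .$$ -/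

import Mathlib

open MeasureTheory ProbabilityTheory Filter Topology

noncomputable section

/-! ### The population quantity -/

/-- `G²_{Y∣X} = 1 - exp [E {log var(Y ∣ X)} - log var(Y)]`. -/
def popGsqCond {Ω : Type*} [MeasurableSpace Ω] (P : Measure Ω) (X Y : Ω → ℝ) : ℝ :=
  1 - Real.exp
    ((∫ ω, Real.log ((Var[Y; P | MeasurableSpace.comap X inferInstance]) ω) ∂P)
      - Real.log (Var[Y; P]))

/-- `G² = max (G²_{Y∣X}, G²_{X∣Y})`. -/
def popGsq {Ω : Type*} [MeasurableSpace Ω] (P : Measure Ω) (X Y : Ω → ℝ) : ℝ :=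
  max (popGsqCond P X Y) (popGsqCond P Y X)

/-! ### Regularity conditions -/

/-- `mean x` is (a version of) `E(Y ∣ X = x)` and `var x` is (a version of) `var(Y ∣ X = x)`. -/
structure IsCondMeanVar {Ω : Type*} [MeasurableSpace Ω] (P : Measure Ω) (X Y : Ω → ℝ)
    (mean var : ℝ → ℝ) : Prop where
  measurable_mean : Measurable mean
  measurable_var : Measurable var
  mean_eq : P[Y | MeasurableSpace.comap X inferInstance] =ᵐ[P] fun ω => mean (X ω)
  var_eq : Var[Y; P | MeasurableSpace.comap X inferInstance] =ᵐ[P] fun ω => var (X ω)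

/-- `f` has a continuous derivative `ρ`-almost everywhere: there is a set of full measure at all
points of which `f` is differentiable, and on which the derivative is continuous. -/
def HasContDerivAE (ρ : Measure ℝ) (f : ℝ → ℝ) : Prop :=
  ∃ D : Set ℝ, (∀ᵐ x ∂ρ, x ∈ D) ∧ (∀ x ∈ D, DifferentiableAt ℝ f x) ∧ ContinuousOn (deriv f) D

/-- A bounded continuous random variable (almost surely bounded, no atoms). -/
structure IsBddContinuousRV {Ω : Type*} [MeasurableSpace Ω] (P : Measure Ω) (X : Ω → ℝ) :
    Prop where
  measurable : Measurable X
  bounded : ∃ M : ℝ, ∀ᵐ ω ∂P, |X ω| ≤ M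
  noAtoms : ∀ x : ℝ, P (X ⁻¹' {x}) = 0

/-- The requirements on the conditional mean `mean` and the conditional variance `var` of one
variable given another one with law `ρ`: the variance is bounded below by `b⁻²`, both functions
have continuous derivatives a.e., and the derivatives of the mean and of the conditional standard
deviation `√var` are bounded by `C` times the conditional standard deviation. -/
structure RegularCondMeanVar (ρ : Measure ℝ) (b C : ℝ) (mean var : ℝ → ℝ) : Prop where
  var_lower : ∀ᵐ x ∂ρ, b⁻¹ ^ 2 < var x
  mean_deriv : HasContDerivAE ρ mean
  var_deriv : HasContDerivAE ρ var
  deriv_bound : ∀ᵐ x ∂ρ,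
    max |deriv mean x| |deriv (fun t => √(var t)) x| ≤ C * √(var x)

/-! ### The estimators

Throughout `x y : Fin n → ℝ` are the observations `(x i, y i)`, in any order. -/

/-- The overall sample variance (maximum likelihood, divisor `n`). -/
def sampleVar {n : ℕ} (y : Fin n → ℝ) : ℝ :=
  (∑ i, (y i - (∑ j, y j) / n) ^ 2) / n

/-- The residual variance after least-squares regression of `y` on `x` with an intercept
(maximum likelihood, divisor `k`). -/
def residVar {k : ℕ} (x y : Fin k → ℝ) : ℝ :=
  (⨅ p : ℝ × ℝ, ∑ j, (y j - (p.1 + p.2 * x j)) ^ 2) / k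

/-- The admissible slicing schemes: divisions of `n` sorted observations into consecutive
non-empty slices, all of size at least `⌈√n⌉`. -/
def slicings (n : ℕ) : Finset (Composition n) :=
  {S | ∀ k ∈ S.blocks, ⌈√(n : ℝ)⌉₊ ≤ k}

theorem slicings_nonempty (n : ℕ) : (slicings n).Nonempty := by
  rcases Nat.eq_zero_or_pos n with rfl | hn
  · exact ⟨default, by simp [slicings]⟩
  · refine ⟨Composition.single n hn, ?_⟩
    simp only [slicings, Finset.mem_filter, Finset.mem_univ, true_and, Composition.single_blocks,
      List.mem_singleton, forall_eq]
    rw [Nat.ceil_le]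
    have h1 : (1 : ℝ) ≤ n := by exact_mod_cast hn
    exact Real.sqrt_le_iff.mpr ⟨by linarith, by nlinarith⟩

/-- The residual variance in the slice `h` of the scheme `S`: the observations are arranged by
increasing `x`, and `y` is regressed on `x` over the slice. -/
def sliceResidVar {n : ℕ} (x y : Fin n → ℝ) (S : Composition n) (h : Fin S.length) : ℝ :=
  residVar (fun j => x (Tuple.sort x (S.embedding h j)))
    (fun j => y (Tuple.sort x (S.embedding h j)))

/-- `log LR_S = (n / 2) log ν̂² - ∑ h, (n_h / 2) log σ̂_h²`. -/
def logLR {n : ℕ} (x y : Fin n → ℝ) (S : Composition n) : ℝ :=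
  (n : ℝ) / 2 * Real.log (sampleVar y)
    - ∑ h : Fin S.length, (S.blocksFun h : ℝ) / 2 * Real.log (sliceResidVar x y S h)

/-- `D(Y ∣ S, lam)`, where `n D(Y ∣ S, lam) = 2 log LR_S - lam (|S| - 1) log n`. -/
def penLogLR (lam : ℝ) {n : ℕ} (x y : Fin n → ℝ) (S : Composition n) : ℝ :=
  (2 * logLR x y S - lam * ((S.length : ℝ) - 1) * Real.log n) / n

/-- `D(Y ∣ X, lam)`, the maximum of `D(Y ∣ S, lam)` over the admissible slicing schemes. -/
def maxPenLogLR (lam : ℝ) {n : ℕ} (x y : Fin n → ℝ) : ℝ :=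
  (slicings n).sup' (slicings_nonempty n) (penLogLR lam x y)

/-- `G_m²(Y ∣ X, lam) = 1 - exp {-D(Y ∣ X, lam)}`. -/
def GmCond (lam : ℝ) {n : ℕ} (x y : Fin n → ℝ) : ℝ :=
  1 - Real.exp (-maxPenLogLR lam x y)

/-- `G_m²(lam)`. -/
def Gm (lam : ℝ) {n : ℕ} (x y : Fin n → ℝ) : ℝ :=
  max (GmCond lam x y) (GmCond lam y x)

/-- `BF*(lam)`, the weighted average of the likelihood ratios of the admissible schemes. -/
def bayesFactor (lam : ℝ) {n : ℕ} (x y : Fin n → ℝ) : ℝ :=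
  (∑ S ∈ slicings n, (n : ℝ) ^ (-(lam * ((S.length : ℝ) - 1) / 2)))⁻¹
    * ∑ S ∈ slicings n, Real.exp ((n : ℝ) / 2 * penLogLR lam x y S)

/-- `G_t²(Y ∣ X, lam) = 1 - BF*(lam) ^ (-2 / n)`. -/
def GtCond (lam : ℝ) {n : ℕ} (x y : Fin n → ℝ) : ℝ :=
  1 - bayesFactor lam x y ^ (-2 / (n : ℝ))

/-- `G_t²(lam)`. -/
def Gt (lam : ℝ) {n : ℕ} (x y : Fin n → ℝ) : ℝ :=
  max (GtCond lam x y) (GtCond lam y x)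

end

/-! Put ℓ = log var(Y) - E log var(Y ∣ X), so that G²_{Y∣X} = 1 - exp(-ℓ). Everything reduces to
`MaxLRLimit`: eventually 2 log LR_S / n is at most ℓ + δ for all admissible S and at least ℓ - δ for
one of them. From there to the estimators nothing is lost in the limit. An admissible scheme has at
most √n slices, so the penalty is O(log n / √n); and there are at most (n + 1)^⌈√n⌉ = exp(o(n))
schemes, so averaging and maximizing give the same exponential rate.

Upper bound (`two_mul_logLR_le`). A fitted line is monotone in x, and remains so when clipped to the
range of y. By Abel summation its inner product with y - E(Y ∣ X) over a slice is controlled by sums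
of y - E(Y ∣ X) over runs of consecutive order statistics. So no line in any slice beats the average
conditional variance by more than a small error, and Jensen's inequality passes to logarithms. The
required control of all runs at once is `ae_eventually_windowBound`: a run is determined by its two
end observations, so a Chernoff bound, a union over n² pairs and Borel-Cantelli suffice. Its error,
a small multiple of the run length plus √n, is harmless because slices contain at least √n points.

Lower bound (`sum_log_sliceResidVar_le`). Take slices of nearly equal size of order √n, fit a
constant c(u) instead of a line, and replace the logarithm by its tangent at φ(u), where c and φ are
continuous approximations of the conditional mean and variance and u is the first point of the
slice. Replacing u by the actual observations costs little, since the widths of the slices telescope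
to at most the diameter 2M. What remains is a sample average, handled by the strong law; its
expectation is close to E log var(Y ∣ X) by L¹ density of continuous functions
(`exists_continuous_integral_logLin_le`). -/

/-! ### Residual sums of squares of a monotone fit -/

/-- Abel summation: pairing with a bounded monotone sequence is controlled by partial sums. -/
lemma abs_sum_mul_le_of_monotone {N : ℕ} {f g : ℕ → ℝ} {A B : ℝ} (hN : 0 < N)
    (hf : ∀ i, i + 1 < N → f i ≤ f (i + 1)) (hB : ∀ i < N, |f i| ≤ B)
    (hA : ∀ k ≤ N, |∑ i ∈ Finset.range k, g i| ≤ A) :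
    |∑ i ∈ Finset.range N, f i * g i| ≤ 3 * B * A := by
  have hA0 : 0 ≤ A := (abs_nonneg _).trans (hA 0 (Nat.zero_le _))
  have key := Finset.sum_range_by_parts f g N
  simp only [smul_eq_mul] at key
  rw [key]
  have h1 : |f (N - 1) * ∑ i ∈ Finset.range N, g i| ≤ B * A := by
    rw [abs_mul]
    exact mul_le_mul (hB _ (by omega)) (hA N le_rfl) (abs_nonneg _)
      ((abs_nonneg _).trans (hB (N - 1) (by omega)))
  have h2 : |∑ i ∈ Finset.range (N - 1), (f (i + 1) - f i) * ∑ j ∈ Finset.range (i + 1), g j|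
      ≤ 2 * B * A := by
    calc _ ≤ ∑ i ∈ Finset.range (N - 1), |(f (i + 1) - f i) * ∑ j ∈ Finset.range (i + 1), g j| :=
          Finset.abs_sum_le_sum_abs _ _
      _ ≤ ∑ i ∈ Finset.range (N - 1), (f (i + 1) - f i) * A := by
          refine Finset.sum_le_sum fun i hi => ?_
          have hi' := Finset.mem_range.1 hi
          have h0 : 0 ≤ f (i + 1) - f i := sub_nonneg.2 (hf i (by omega))
          rw [abs_mul, abs_of_nonneg h0]
          exact mul_le_mul_of_nonneg_left (hA _ (by omega)) h0
      _ = (f (N - 1) - f 0) * A := by rw [← Finset.sum_mul, Finset.sum_range_sub]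
      _ ≤ 2 * B * A := by
          refine mul_le_mul_of_nonneg_right ?_ hA0
          have a1 := abs_le.1 (hB (N - 1) (by omega))
          have a2 := abs_le.1 (hB 0 hN)
          linarith
  calc _ ≤ _ := abs_sub _ _
    _ ≤ 3 * B * A := by linarith

lemma abs_sum_mul_le_of_antitone {N : ℕ} {f g : ℕ → ℝ} {A B : ℝ} (hN : 0 < N)
    (hf : ∀ i, i + 1 < N → f (i + 1) ≤ f i) (hB : ∀ i < N, |f i| ≤ B)
    (hA : ∀ k ≤ N, |∑ i ∈ Finset.range k, g i| ≤ A) :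
    |∑ i ∈ Finset.range N, f i * g i| ≤ 3 * B * A := by
  have := abs_sum_mul_le_of_monotone (f := fun i => - f i) hN (fun i hi => neg_le_neg (hf i hi))
    (fun i hi => by simpa using hB i hi) hA
  simpa [Finset.sum_neg_distrib] using this

/-- Clipping is the metric projection onto [-B, B], an interval that contains y. It makes an
arbitrary line bounded without increasing its residuals. -/
lemma sq_sub_clip_le {B y t : ℝ} (hy : |y| ≤ B) :
    (y - max (-B) (min B t)) ^ 2 ≤ (y - t) ^ 2 := by
  have := abs_le.1 hy
  rcases le_total B t with h | h
  · rw [min_eq_left h, max_eq_right (by linarith)]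
    nlinarith
  · rw [min_eq_right h]
    rcases le_total (-B) t with h' | h'
    · rw [max_eq_right h']
    · rw [max_eq_left h']
      nlinarith

lemma abs_clip_le {B t : ℝ} (hB : 0 ≤ B) : |max (-B) (min B t)| ≤ B :=
  abs_le.2 ⟨le_max_left _ _, max_le (by linarith) (min_le_left _ _)⟩

/-- Lower bound for the residual sum of squares of a linear fit over a sorted window. -/
lemma sum_sq_residual_ge {N : ℕ} {x y m q : ℕ → ℝ} {A B : ℝ}
    (hx : ∀ i, i + 1 < N → x i ≤ x (i + 1)) (hN : 0 < N) (hy : ∀ i < N, |y i| ≤ B)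
    (hm : ∀ k ≤ N, |∑ i ∈ Finset.range k, (y i - m i)| ≤ A)
    (hq : |∑ i ∈ Finset.range N, (y i ^ 2 - q i)| ≤ A) (α β : ℝ) :
    ∑ i ∈ Finset.range N, (q i - m i ^ 2) - (1 + 6 * B) * A
      ≤ ∑ i ∈ Finset.range N, (y i - (α + β * x i)) ^ 2 := by
  have hB : 0 ≤ B := (abs_nonneg _).trans (hy 0 hN)
  -- The slope and intercept are arbitrary, so the line itself has no useful bound; its clipped
  -- version is bounded by B and still monotone.
  set f : ℕ → ℝ := fun i => max (-B) (min B (α + β * x i)) with hf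
  have hfg : |∑ i ∈ Finset.range N, f i * (y i - m i)| ≤ 3 * B * A := by
    -- The sign of the slope decides whether the clipped line increases or decreases along the
    -- sorted window.
    rcases le_total 0 β with hβ | hβ
    · refine abs_sum_mul_le_of_monotone hN (fun i hi => ?_) (fun i _ => abs_clip_le hB) hm
      have := mul_le_mul_of_nonneg_left (hx i hi) hβ
      exact max_le_max le_rfl (min_le_min le_rfl (by linarith))
    · refine abs_sum_mul_le_of_antitone hN (fun i hi => ?_) (fun i _ => abs_clip_le hB) hm
      have := mul_le_mul_of_nonpos_left (hx i hi) hβ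
      exact max_le_max le_rfl (min_le_min le_rfl (by linarith))
  have h1 : ∑ i ∈ Finset.range N, (y i - f i) ^ 2
      ≤ ∑ i ∈ Finset.range N, (y i - (α + β * x i)) ^ 2 :=
    Finset.sum_le_sum fun i hi => sq_sub_clip_le (hy i (Finset.mem_range.1 hi))
  -- Expansion around m: the (m - f)² term may be dropped, the second sum costs A, and the cross
  -- term costs 2 · 3BA.
  have h2 : ∑ i ∈ Finset.range N, (y i - f i) ^ 2
      = ∑ i ∈ Finset.range N, (q i - m i ^ 2) + ∑ i ∈ Finset.range N, (y i ^ 2 - q i)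
        - 2 * ∑ i ∈ Finset.range N, f i * (y i - m i)
        + ∑ i ∈ Finset.range N, (m i - f i) ^ 2 := by
    rw [Finset.mul_sum, ← Finset.sum_add_distrib, ← Finset.sum_sub_distrib,
      ← Finset.sum_add_distrib]
    exact Finset.sum_congr rfl fun i _ => by ring
  have h3 : 0 ≤ ∑ i ∈ Finset.range N, (m i - f i) ^ 2 := Finset.sum_nonneg fun i _ => sq_nonneg _
  have a1 := abs_le.1 hfg
  have a2 := abs_le.1 hq
  linarith

/-! ### Order windows, slices, and the uniform upper bound for the likelihood ratio -/

/-- The sums of `f` over the order windows of `x` are small compared to their size plus `√n`. -/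
def WindowBound {n : ℕ} (x f : Fin n → ℝ) (δ : ℝ) : Prop :=
  ∀ a b : Fin n, |∑ i, if x a ≤ x i ∧ x i ≤ x b then f i else 0|
    ≤ δ * ((∑ i, if x a ≤ x i ∧ x i ≤ x b then (1 : ℝ) else 0) + √n)

/-- A finite sequence arranged by increasing `x`, extended by zero. -/
noncomputable def sortedExt {n : ℕ} (x f : Fin n → ℝ) (l : ℕ) : ℝ :=
  if h : l < n then f (Tuple.sort x ⟨l, h⟩) else 0

lemma sortedExt_embedding {n : ℕ} (x f : Fin n → ℝ) (S : Composition n) (h : Fin S.length)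
    (j : Fin (S.blocksFun h)) :
    sortedExt x f (S.sizeUpTo h + j) = f (Tuple.sort x (S.embedding h j)) := by
  have : S.sizeUpTo h + (j : ℕ) < n := by
    rw [← S.coe_embedding h j]; exact (S.embedding h j).2
  rw [sortedExt, dif_pos this]
  rfl

lemma strictMono_comp_sort {n : ℕ} {x : Fin n → ℝ} (hx : Function.Injective x) :
    StrictMono (x ∘ Tuple.sort x) :=
  (Tuple.monotone_sort x).strictMono_of_injective (hx.comp (Tuple.sort x).injective)

/-- Without ties, a value window whose endpoints are observations is exactly a run of consecutive
ranks. This links the probabilistic estimate, stated for values, to slices, stated for ranks. -/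
lemma sum_window_eq {n : ℕ} {x : Fin n → ℝ} (hx : Function.Injective x) (f : Fin n → ℝ)
    {p k : ℕ} (hk : 0 < k) (hpk : p + k ≤ n) :
    (∑ i, if x (Tuple.sort x ⟨p, by omega⟩) ≤ x i ∧ x i ≤ x (Tuple.sort x ⟨p + k - 1, by omega⟩)
      then f i else 0) = ∑ j ∈ Finset.range k, sortedExt x f (p + j) := by
  have hs := strictMono_comp_sort hx
  rw [← Equiv.sum_comp (Tuple.sort x)]
  have h1 : ∀ l : Fin n, (if x (Tuple.sort x ⟨p, by omega⟩) ≤ x (Tuple.sort x l) ∧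
      x (Tuple.sort x l) ≤ x (Tuple.sort x ⟨p + k - 1, by omega⟩)
      then f (Tuple.sort x l) else 0)
      = (fun l : ℕ => if p ≤ l ∧ l < p + k then sortedExt x f l else 0) l := by
    intro l
    have e1 := hs.le_iff_le (a := ⟨p, by omega⟩) (b := l)
    have e2 := hs.le_iff_le (a := l) (b := ⟨p + k - 1, by omega⟩)
    simp only [Function.comp] at e1 e2
    simp only [e1, e2, Fin.le_def, sortedExt, l.2, dif_pos]
    congr 1
    simp only [eq_iff_iff]
    omega
  rw [Finset.sum_congr rfl fun l _ => h1 l, Fin.sum_univ_eq_sum_range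
    (fun l : ℕ => if p ≤ l ∧ l < p + k then sortedExt x f l else 0), ← Finset.sum_filter]
  have h2 : (Finset.range n).filter (fun l => p ≤ l ∧ l < p + k) = Finset.Ico p (p + k) := by
    ext l; simp; omega
  rw [h2, Finset.sum_Ico_eq_sum_range]
  simp

lemma WindowBound.abs_sum_sortedExt_le {n : ℕ} {x f : Fin n → ℝ} {δ : ℝ}
    (hf : WindowBound x f δ) (hδ : 0 ≤ δ) (hx : Function.Injective x) {p k : ℕ}
    (hpk : p + k ≤ n) :
    |∑ j ∈ Finset.range k, sortedExt x f (p + j)| ≤ δ * (k + √n) := by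
  rcases Nat.eq_zero_or_pos k with rfl | hk
  · simp; positivity
  have h1 := hf (Tuple.sort x ⟨p, by omega⟩) (Tuple.sort x ⟨p + k - 1, by omega⟩)
  rw [sum_window_eq hx f hk hpk, sum_window_eq hx (fun _ => 1) hk hpk] at h1
  refine h1.trans (le_of_eq ?_)
  congr 2
  rw [Finset.sum_congr rfl (g := fun _ => (1 : ℝ))]
  · simp
  · intro j hj
    have := Finset.mem_range.1 hj
    rw [sortedExt, dif_pos (by omega)]

lemma mem_slicings {n : ℕ} {S : Composition n} :
    S ∈ slicings n ↔ ∀ k ∈ S.blocks, ⌈√(n : ℝ)⌉₊ ≤ k := by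
  simp [slicings]

lemma sqrt_le_blocksFun {n : ℕ} {S : Composition n} (hS : S ∈ slicings n) (h : Fin S.length) :
    √(n : ℝ) ≤ S.blocksFun h :=
  Nat.ceil_le.1 (mem_slicings.1 hS _ (S.blocksFun_mem_blocks h))

lemma sizeUpTo_add_blocksFun_le {n : ℕ} (S : Composition n) (h : Fin S.length) :
    S.sizeUpTo h + S.blocksFun h ≤ n := by
  have := S.sizeUpTo_succ' h
  have h2 := S.sizeUpTo_le (h + 1)
  omega

lemma sum_embedding_eq_range {n : ℕ} (x f : Fin n → ℝ) (S : Composition n) (h : Fin S.length) :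
    ∑ j, f (Tuple.sort x (S.embedding h j))
      = ∑ j ∈ Finset.range (S.blocksFun h), sortedExt x f (S.sizeUpTo h + j) := by
  rw [← Fin.sum_univ_eq_sum_range (fun j => sortedExt x f (S.sizeUpTo h + j))]
  exact Finset.sum_congr rfl fun j _ => (sortedExt_embedding x f S h j).symm

lemma sum_slices {n : ℕ} (x f : Fin n → ℝ) (S : Composition n) :
    ∑ h, ∑ j, f (Tuple.sort x (S.embedding h j)) = ∑ i, f i := by
  rw [Composition.sum_sum_apply_embedding (fun i => f (Tuple.sort x i)), Equiv.sum_comp]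

lemma sortedExt_mono {n : ℕ} (x : Fin n → ℝ) {l k : ℕ} (hlk : l ≤ k) (hk : k < n) :
    sortedExt x x l ≤ sortedExt x x k := by
  rw [sortedExt, sortedExt, dif_pos (by omega), dif_pos hk]
  exact Tuple.monotone_sort x (by simpa using hlk)

/-- Under window bounds, the residual variance of every admissible slice is at least the average
conditional variance up to a small error. -/
lemma blocksFun_mul_sliceResidVar_ge {n : ℕ} {x y : Fin n → ℝ} {m v : ℝ → ℝ} {δ B : ℝ}
    (hx : Function.Injective x) (hy : ∀ i, |y i| ≤ B) (hδ : 0 ≤ δ)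
    (hm : WindowBound x (fun i => y i - m (x i)) δ)
    (hq : WindowBound x (fun i => y i ^ 2 - (m (x i) ^ 2 + v (x i))) δ)
    {S : Composition n} (hS : S ∈ slicings n) (h : Fin S.length) :
    ∑ j, v (x (Tuple.sort x (S.embedding h j))) - (1 + 6 * B) * (2 * δ) * S.blocksFun h
      ≤ S.blocksFun h * sliceResidVar x y S h := by
  have hN : 0 < S.blocksFun h := S.one_le_blocksFun h
  have hle := sizeUpTo_add_blocksFun_le S h
  -- The minimal slice size enters here: for k ≤ n_h the window error δ(k + √n) is at most 2δ n_h.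
  have hsq := sqrt_le_blocksFun hS h
  have hN' : (S.blocksFun h : ℝ) ≠ 0 := by positivity
  rw [sliceResidVar, residVar, mul_div_cancel₀ _ hN']
  refine le_ciInf fun p => ?_
  have key := sum_sq_residual_ge (N := S.blocksFun h)
    (x := fun j => sortedExt x x (S.sizeUpTo h + j))
    (y := fun j => sortedExt x y (S.sizeUpTo h + j))
    (m := fun j => sortedExt x (fun i => m (x i)) (S.sizeUpTo h + j))
    (q := fun j => sortedExt x (fun i => m (x i) ^ 2 + v (x i)) (S.sizeUpTo h + j))
    (A := 2 * δ * S.blocksFun h) (B := B)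
    (fun i hi => sortedExt_mono x (by omega) (by omega)) hN
    (fun i hi => by
      rw [sortedExt, dif_pos (by omega)]
      exact hy _)
    (fun k hk => by
      have h1 := hm.abs_sum_sortedExt_le hδ hx (p := S.sizeUpTo h) (k := k) (by omega)
      rw [Finset.sum_congr rfl (g := fun j =>
        sortedExt x (fun i => y i - m (x i)) (S.sizeUpTo h + j))]
      · refine h1.trans ?_
        have : (k : ℝ) ≤ S.blocksFun h := by exact_mod_cast hk
        nlinarith
      · intro j hj
        have := Finset.mem_range.1 hj
        simp only [sortedExt]
        rw [dif_pos (by omega), dif_pos (by omega), dif_pos (by omega)])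
    (by
      have h1 := hq.abs_sum_sortedExt_le hδ hx (p := S.sizeUpTo h) (k := S.blocksFun h) (by omega)
      rw [Finset.sum_congr rfl (g := fun j =>
        sortedExt x (fun i => y i ^ 2 - (m (x i) ^ 2 + v (x i))) (S.sizeUpTo h + j))]
      · refine h1.trans ?_
        nlinarith
      · intro j hj
        have := Finset.mem_range.1 hj
        simp only [sortedExt]
        rw [dif_pos (by omega), dif_pos (by omega), dif_pos (by omega)]) p.1 p.2
  have e1 : ∑ j, v (x (Tuple.sort x (S.embedding h j))) = ∑ j ∈ Finset.range (S.blocksFun h),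
      (sortedExt x (fun i => m (x i) ^ 2 + v (x i)) (S.sizeUpTo h + j)
        - sortedExt x (fun i => m (x i)) (S.sizeUpTo h + j) ^ 2) := by
    rw [sum_embedding_eq_range x (fun i => v (x i))]
    refine Finset.sum_congr rfl fun j hj => ?_
    have := Finset.mem_range.1 hj
    simp only [sortedExt]
    rw [dif_pos (by omega), dif_pos (by omega), dif_pos (by omega)]
    ring
  have e2 : ∑ j, (y (Tuple.sort x (S.embedding h j))
      - (p.1 + p.2 * x (Tuple.sort x (S.embedding h j)))) ^ 2
      = ∑ j ∈ Finset.range (S.blocksFun h), (sortedExt x y (S.sizeUpTo h + j)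
        - (p.1 + p.2 * sortedExt x x (S.sizeUpTo h + j))) ^ 2 := by
    rw [sum_embedding_eq_range x (fun i => (y i - (p.1 + p.2 * x i)) ^ 2)]
    refine Finset.sum_congr rfl fun j hj => ?_
    have := Finset.mem_range.1 hj
    simp only [sortedExt]
    rw [dif_pos (by omega), dif_pos (by omega), dif_pos (by omega)]
  rw [e1, e2]
  linarith

/-- Jensen's inequality for the logarithm. -/
lemma sum_log_le_card_mul_log {N : ℕ} (hN : 0 < N) {w : Fin N → ℝ} (hw : ∀ i, 0 < w i) :
    ∑ i, Real.log (w i) ≤ N * Real.log ((∑ i, w i) / N) := by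
  have hN' : (0 : ℝ) < N := by exact_mod_cast hN
  have := strictConcaveOn_log_Ioi.concaveOn.le_map_sum (t := Finset.univ)
    (w := fun _ : Fin N => (N : ℝ)⁻¹) (p := w) (fun _ _ => by positivity)
    (by simp [hN'.ne']) (fun i _ => hw i)
  simp only [smul_eq_mul, ← Finset.mul_sum] at this
  rw [div_eq_inv_mul]
  calc _ = N * ((N : ℝ)⁻¹ * ∑ i, Real.log (w i)) := by field_simp
    _ ≤ _ := mul_le_mul_of_nonneg_left this hN'.le

/-- The lower bound v₀ turns the additive error of the residual variance into a relative one, after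
which Jensen's inequality applies. Positivity is recorded because the tangent bound for the
logarithm in the opposite estimate needs it. -/
lemma blocksFun_mul_log_sliceResidVar_ge {n : ℕ} {x y : Fin n → ℝ} {m v : ℝ → ℝ} {δ B v₀ ε : ℝ}
    (hx : Function.Injective x) (hy : ∀ i, |y i| ≤ B) (hδ : 0 ≤ δ)
    (hm : WindowBound x (fun i => y i - m (x i)) δ)
    (hq : WindowBound x (fun i => y i ^ 2 - (m (x i) ^ 2 + v (x i))) δ)
    (hv₀ : 0 < v₀) (hv : ∀ i, v₀ ≤ v (x i)) (hε : ε < 1) (hε0 : 0 ≤ ε)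
    (hδε : (1 + 6 * B) * (2 * δ) ≤ ε * v₀)
    {S : Composition n} (hS : S ∈ slicings n) (h : Fin S.length) :
    0 < sliceResidVar x y S h ∧
    ∑ j, Real.log (v (x (Tuple.sort x (S.embedding h j)))) + S.blocksFun h * Real.log (1 - ε)
      ≤ S.blocksFun h * Real.log (sliceResidVar x y S h) := by
  have hN₀ : 0 < S.blocksFun h := S.one_le_blocksFun h
  have hN' : (0 : ℝ) < S.blocksFun h := by exact_mod_cast hN₀
  have key := blocksFun_mul_sliceResidVar_ge hx hy hδ hm hq hS h
  set V := ∑ j, v (x (Tuple.sort x (S.embedding h j))) with hV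
  set N : ℝ := (S.blocksFun h : ℝ)
  have hVN : v₀ * N ≤ V := by
    calc v₀ * N = ∑ j : Fin (S.blocksFun h), v₀ := by simp [N, mul_comm]
      _ ≤ V := Finset.sum_le_sum fun j _ => hv _
  -- The error is at most ε v₀ N, hence at most ε V.
  have h1 : V / N * (1 - ε) ≤ sliceResidVar x y S h := by
    rw [div_mul_eq_mul_div, div_le_iff₀ hN']
    nlinarith
  have hVN' : 0 < V / N := lt_of_lt_of_le hv₀ ((le_div_iff₀ hN').2 hVN)
  have h2 : 0 < V / N * (1 - ε) := mul_pos hVN' (by linarith)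
  refine ⟨h2.trans_le h1, ?_⟩
  have h3 := Real.log_le_log h2 h1
  rw [Real.log_mul hVN'.ne' (by linarith)] at h3
  have h4 := sum_log_le_card_mul_log hN₀
    (w := fun j => v (x (Tuple.sort x (S.embedding h j)))) (fun j => hv₀.trans_le (hv _))
  calc _ ≤ N * Real.log (V / N) + N * Real.log (1 - ε) := by linarith
    _ = N * (Real.log (V / N) + Real.log (1 - ε)) := by ring
    _ ≤ _ := mul_le_mul_of_nonneg_left h3 hN'.le

lemma sum_blocksFun_cast {n : ℕ} (S : Composition n) : ∑ h, (S.blocksFun h : ℝ) = n := by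
  exact_mod_cast S.sum_blocksFun

/-- Upper bound for the likelihood ratio, uniform over the admissible slicings. -/
lemma two_mul_logLR_le {n : ℕ} {x y : Fin n → ℝ} {m v : ℝ → ℝ} {δ B v₀ ε : ℝ}
    (hx : Function.Injective x) (hy : ∀ i, |y i| ≤ B) (hδ : 0 ≤ δ)
    (hm : WindowBound x (fun i => y i - m (x i)) δ)
    (hq : WindowBound x (fun i => y i ^ 2 - (m (x i) ^ 2 + v (x i))) δ)
    (hv₀ : 0 < v₀) (hv : ∀ i, v₀ ≤ v (x i)) (hε : ε < 1) (hε0 : 0 ≤ ε)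
    (hδε : (1 + 6 * B) * (2 * δ) ≤ ε * v₀)
    {S : Composition n} (hS : S ∈ slicings n) :
    2 * logLR x y S
      ≤ n * Real.log (sampleVar y) - ∑ i, Real.log (v (x i)) - n * Real.log (1 - ε) := by
  have h1 := Finset.sum_le_sum fun (h : Fin S.length) (_ : h ∈ Finset.univ) =>
    (blocksFun_mul_log_sliceResidVar_ge hx hy hδ hm hq hv₀ hv hε hε0 hδε hS h).2
  rw [Finset.sum_add_distrib, sum_slices x (fun i => Real.log (v (x i))), ← Finset.sum_mul,
    sum_blocksFun_cast] at h1
  have h2 : 2 * logLR x y S = n * Real.log (sampleVar y)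
      - ∑ h, S.blocksFun h * Real.log (sliceResidVar x y S h) := by
    rw [logLR, mul_sub, Finset.mul_sum]
    congr 1
    · ring
    · exact Finset.sum_congr rfl fun h _ => by ring
  linarith

/-! ### Nearly equal slices and the lower bound for the likelihood ratio -/

/-- The composition of `n` into `n / m` blocks, all equal to `m` except possibly the last. -/
def equalBlocks (n m : ℕ) (hm : 0 < m) (hmn : m ≤ n) : Composition n where
  blocks := List.replicate (n / m - 1) m ++ [n - (n / m - 1) * m]
  blocks_pos := by
    intro i hi
    have h1 := Nat.div_pos hmn hm
    have h2 := Nat.div_mul_le_self n m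
    have h3 : (n / m - 1) * m + m = n / m * m := by
      rw [← Nat.succ_mul]; congr 1; omega
    simp only [List.mem_append, List.mem_replicate, List.mem_singleton] at hi
    omega
  blocks_sum := by
    have h2 := Nat.div_mul_le_self n m
    have h3 : (n / m - 1) * m ≤ n / m * m := Nat.mul_le_mul_right _ (Nat.sub_le _ _)
    simp only [List.sum_append, List.sum_replicate, List.sum_singleton, smul_eq_mul]
    omega

/-- The remainder of the division is absorbed by the last block, so that no block falls below m;
that block stays below 2m. -/
lemma mem_equalBlocks {n m : ℕ} {hm : 0 < m} {hmn : m ≤ n} {k : ℕ}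
    (hk : k ∈ (equalBlocks n m hm hmn).blocks) : m ≤ k ∧ k ≤ 2 * m := by
  have h1 := Nat.div_pos hmn hm
  have h2 := Nat.div_mul_le_self n m
  have h3 : (n / m - 1) * m + m = n / m * m := by
    rw [← Nat.succ_mul]; congr 1; omega
  have h4 := Nat.lt_div_mul_add (a := n) hm
  simp only [equalBlocks, List.mem_append, List.mem_replicate, List.mem_singleton] at hk
  omega

/-- A continuous function has an affine modulus of continuity on a compact interval. -/
lemma exists_affine_modulus {F : ℝ → ℝ} (hF : Continuous F) (M : ℝ) {η : ℝ} (hη : 0 < η) :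
    ∃ L, 0 ≤ L ∧ ∀ u ∈ Set.Icc (-M) M, ∀ w ∈ Set.Icc (-M) M,
      |F u - F w| ≤ η + L * |u - w| := by
  have hc : IsCompact (Set.Icc (-M) M) := isCompact_Icc
  obtain ⟨τ, hτ, hu⟩ := Metric.uniformContinuousOn_iff.1
    (hc.uniformContinuousOn_of_continuous hF.continuousOn) η hη
  obtain ⟨A, hA⟩ := hc.exists_bound_of_continuousOn hF.continuousOn
  -- At distances below τ the constant η suffices; beyond τ the linear term already exceeds twice
  -- the supremum of |F|. The linear form is what allows the bound to be summed over slices by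
  -- telescoping.
  refine ⟨2 * max A 0 / τ, by positivity, fun u hu' w hw' => ?_⟩
  have hA0 : 0 ≤ max A 0 := le_max_right _ _
  rcases lt_or_ge (dist u w) τ with h | h
  · have := (hu u hu' w hw' h).le
    rw [Real.dist_eq] at this
    have : 0 ≤ 2 * max A 0 / τ * |u - w| := by positivity
    linarith
  · rw [Real.dist_eq] at h
    have h1 : 2 * max A 0 ≤ 2 * max A 0 / τ * |u - w| := by
      rw [div_mul_eq_mul_div, le_div_iff₀ hτ]
      exact mul_le_mul_of_nonneg_left h (by positivity)
    have h2 := hA u hu'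
    have h3 := hA w hw'
    rw [Real.norm_eq_abs] at h2 h3
    have h4 := abs_sub (F u) (F w)
    have := le_max_left A 0
    linarith

/-- The linearization at `φ u` of the logarithm of the squared deviation of `y` from `c u`. -/
noncomputable def logLin (φ c : ℝ → ℝ) (u y : ℝ) : ℝ :=
  Real.log (φ u) - 1 + (y - c u) ^ 2 / φ u

/-- `logLin φ c u y` is a quadratic polynomial in y whose three coefficients are continuous in u.
Each has an affine modulus, and 1 + B + B² bounds their combined weight when |y| ≤ B. -/
lemma exists_logLin_modulus {φ c : ℝ → ℝ} (hφ : Continuous φ) (hc : Continuous c)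
    (hφ0 : ∀ u, 0 < φ u) (M : ℝ) {B : ℝ} (hB : 0 ≤ B) {η : ℝ} (hη : 0 < η) :
    ∃ L, 0 ≤ L ∧ ∀ u ∈ Set.Icc (-M) M, ∀ w ∈ Set.Icc (-M) M, ∀ y, |y| ≤ B →
      logLin φ c u y ≤ logLin φ c w y + (η + L * |u - w|) := by
  have hφ' : ∀ u, φ u ≠ 0 := fun u => (hφ0 u).ne'
  have hK : 0 < 1 + B + B ^ 2 := by positivity
  obtain ⟨L₀, h0, hF0⟩ := exists_affine_modulus
    (F := fun u => Real.log (φ u) - 1 + c u ^ 2 / φ u)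
    (((hφ.log hφ').sub continuous_const).add ((hc.pow 2).div hφ hφ')) M
    (η := η / (1 + B + B ^ 2)) (by positivity)
  obtain ⟨L₁, h1, hF1⟩ := exists_affine_modulus (F := fun u => 2 * c u / φ u)
    ((continuous_const.mul hc).div hφ hφ') M
    (η := η / (1 + B + B ^ 2)) (by positivity)
  obtain ⟨L₂, h2, hF2⟩ := exists_affine_modulus (F := fun u => 1 / φ u)
    (continuous_const.div hφ hφ') M
    (η := η / (1 + B + B ^ 2)) (by positivity)
  refine ⟨L₀ + B * L₁ + B ^ 2 * L₂, by positivity, fun u hu w hw y hy => ?_⟩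
  have a0 := (abs_le.1 (hF0 u hu w hw)).2
  have a1 := hF1 u hu w hw
  have a2 := (abs_le.1 (hF2 u hu w hw)).2
  have e : logLin φ c u y - logLin φ c w y
      = ((Real.log (φ u) - 1 + c u ^ 2 / φ u) - (Real.log (φ w) - 1 + c w ^ 2 / φ w))
        - y * (2 * c u / φ u - 2 * c w / φ w) + y ^ 2 * (1 / φ u - 1 / φ w) := by
    simp only [logLin]; ring
  have b1 : - (y * (2 * c u / φ u - 2 * c w / φ w))
      ≤ B * (η / (1 + B + B ^ 2) + L₁ * |u - w|) := by
    refine (neg_le_abs _).trans ?_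
    rw [abs_mul]
    exact mul_le_mul hy a1 (abs_nonneg _) hB
  have hy2 : y ^ 2 ≤ B ^ 2 := sq_le_sq' (by linarith [(abs_le.1 hy).1]) (abs_le.1 hy).2
  have b2 : y ^ 2 * (1 / φ u - 1 / φ w) ≤ B ^ 2 * (η / (1 + B + B ^ 2) + L₂ * |u - w|) :=
    calc _ ≤ y ^ 2 * (η / (1 + B + B ^ 2) + L₂ * |u - w|) :=
          mul_le_mul_of_nonneg_left a2 (sq_nonneg _)
      _ ≤ _ := mul_le_mul_of_nonneg_right hy2 (by positivity)
  have e2 : η / (1 + B + B ^ 2) + B * (η / (1 + B + B ^ 2)) + B ^ 2 * (η / (1 + B + B ^ 2))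
      = η := by field_simp
  nlinarith

lemma residVar_le {k : ℕ} (x y : Fin k → ℝ) (t : ℝ) :
    residVar x y ≤ (∑ j, (y j - t) ^ 2) / k := by
  rw [residVar]
  refine div_le_div_of_nonneg_right ?_ (Nat.cast_nonneg k)
  have h : BddBelow (Set.range fun p : ℝ × ℝ => ∑ j, (y j - (p.1 + p.2 * x j)) ^ 2) :=
    ⟨0, by rintro _ ⟨p, rfl⟩; exact Finset.sum_nonneg fun j _ => sq_nonneg _⟩
  refine (ciInf_le h (t, 0)).trans (le_of_eq ?_)
  simp

lemma log_le_log_add_div {s a : ℝ} (hs : 0 < s) (ha : 0 < a) :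
    Real.log s ≤ Real.log a - 1 + s / a := by
  have := Real.log_le_sub_one_of_pos (div_pos hs ha)
  rw [Real.log_div hs.ne' ha.ne'] at this
  linarith

/-- The sorted sample, extended by an upper bound `M`. -/
noncomputable def sortedCap {n : ℕ} (x : Fin n → ℝ) (M : ℝ) (l : ℕ) : ℝ :=
  if h : l < n then x (Tuple.sort x ⟨l, h⟩) else M

lemma monotone_sortedCap {n : ℕ} {x : Fin n → ℝ} {M : ℝ} (hx : ∀ i, x i ≤ M) :
    Monotone (sortedCap x M) := by
  intro l k hlk
  unfold sortedCap
  split_ifs with h1 h2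
  · exact Tuple.monotone_sort x (by simpa using hlk)
  · exact hx _
  · omega
  · exact le_rfl

/-- For schemes with small slices the sum of the logarithms of the residual variances is bounded
above by a linearization, evaluated at the observations. -/
lemma sum_log_sliceResidVar_le {n : ℕ} {x y : Fin n → ℝ} {φ c : ℝ → ℝ} {M B η L : ℝ} {K : ℕ}
    (hM : 0 ≤ M) (hx : ∀ i, |x i| ≤ M) (hy : ∀ i, |y i| ≤ B) (hφ0 : ∀ u, 0 < φ u)
    (hL : 0 ≤ L)
    (hmod : ∀ u ∈ Set.Icc (-M) M, ∀ w ∈ Set.Icc (-M) M, ∀ y, |y| ≤ B →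
      logLin φ c u y ≤ logLin φ c w y + (η + L * |u - w|))
    (S : Composition n) (hS : ∀ k ∈ S.blocks, k ≤ K) (hpos : ∀ h, 0 < sliceResidVar x y S h) :
    ∑ h, S.blocksFun h * Real.log (sliceResidVar x y S h)
      ≤ ∑ i, logLin φ c (x i) (y i) + n * η + L * K * (2 * M) := by
  set X := sortedCap x M with hX
  have hmono : Monotone X := monotone_sortedCap fun i => (abs_le.1 (hx i)).2
  have hslice : ∀ h : Fin S.length, S.blocksFun h * Real.log (sliceResidVar x y S h)
      ≤ ∑ j, logLin φ c (x (Tuple.sort x (S.embedding h j))) (y (Tuple.sort x (S.embedding h j)))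
        + S.blocksFun h * η + L * K * (X (S.sizeUpTo (h + 1)) - X (S.sizeUpTo h)) := by
    intro h
    have hN₀ : 0 < S.blocksFun h := S.one_le_blocksFun h
    have hN : (0 : ℝ) < S.blocksFun h := by exact_mod_cast hN₀
    have hK : (S.blocksFun h : ℝ) ≤ K := by exact_mod_cast hS _ (S.blocksFun_mem_blocks h)
    -- The linearization point is the first observation of the slice.
    set u := x (Tuple.sort x (S.embedding h ⟨0, hN₀⟩)) with hu
    -- The gap runs to the first observation of the next slice (to M for the last one), so that it
    -- dominates the width of the slice and the gaps telescope exactly.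
    set r := X (S.sizeUpTo (h + 1)) - X (S.sizeUpTo h) with hr
    have hr0 : 0 ≤ r := sub_nonneg.2 (hmono (S.monotone_sizeUpTo (Nat.le_succ _)))
    have hXe : ∀ j : Fin (S.blocksFun h),
        X (S.sizeUpTo h + j) = x (Tuple.sort x (S.embedding h j)) := by
      intro j
      have : S.sizeUpTo h + (j : ℕ) < n := by
        rw [← S.coe_embedding h j]; exact (S.embedding h j).2
      rw [hX, sortedCap, dif_pos this]
      rfl
    have hdist : ∀ j, |u - x (Tuple.sort x (S.embedding h j))| ≤ r := by
      intro j
      rw [hu, ← hXe, ← hXe, hr, S.sizeUpTo_succ' h, abs_le]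
      have a1 := hmono (show S.sizeUpTo h ≤ S.sizeUpTo h + (j : ℕ) by omega)
      have a2 := hmono (show S.sizeUpTo h + (j : ℕ) ≤ S.sizeUpTo h + S.blocksFun h by omega)
      simp only [add_zero]
      constructor <;> linarith
    have h1 := log_le_log_add_div (hpos h) (hφ0 u)
    have h2 := residVar_le (fun j => x (Tuple.sort x (S.embedding h j)))
      (fun j => y (Tuple.sort x (S.embedding h j))) (c u)
    change sliceResidVar x y S h ≤ _ at h2
    have h3 : S.blocksFun h * Real.log (sliceResidVar x y S h)
        ≤ ∑ j, logLin φ c u (y (Tuple.sort x (S.embedding h j))) := by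
      calc _ ≤ (S.blocksFun h : ℝ) * (Real.log (φ u) - 1
            + (∑ j, (y (Tuple.sort x (S.embedding h j)) - c u) ^ 2) / S.blocksFun h / φ u) := by
            refine mul_le_mul_of_nonneg_left (h1.trans ?_) hN.le
            have := div_le_div_of_nonneg_right h2 (hφ0 u).le
            linarith
        _ = _ := by
            simp only [logLin, Finset.sum_add_distrib, ← Finset.sum_div]
            have := (hφ0 u).ne'
            simp only [Finset.sum_const, Finset.card_univ, Fintype.card_fin, nsmul_eq_mul]
            field_simp
    have h4 : ∑ j, logLin φ c u (y (Tuple.sort x (S.embedding h j)))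
        ≤ ∑ j, (logLin φ c (x (Tuple.sort x (S.embedding h j)))
          (y (Tuple.sort x (S.embedding h j))) + (η + L * r)) := by
      refine Finset.sum_le_sum fun j _ => ?_
      refine (hmod u (abs_le.1 (hx _)) _
        (abs_le.1 (hx (Tuple.sort x (S.embedding h j)))) _ (hy _)).trans ?_
      have := mul_le_mul_of_nonneg_left (hdist j) hL
      linarith
    rw [Finset.sum_add_distrib] at h4
    simp only [Finset.sum_const, Finset.card_univ, Fintype.card_fin, nsmul_eq_mul] at h4
    have h5 : S.blocksFun h * (L * r) ≤ K * (L * r) :=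
      mul_le_mul_of_nonneg_right hK (by positivity)
    linarith
  have hsum := Finset.sum_le_sum fun (h : Fin S.length) (_ : h ∈ Finset.univ) => hslice h
  rw [Finset.sum_add_distrib, Finset.sum_add_distrib, ← Finset.mul_sum, ← Finset.sum_mul,
    sum_blocksFun_cast, sum_slices x (fun i => logLin φ c (x i) (y i)),
    Fin.sum_univ_eq_sum_range (fun h => X (S.sizeUpTo (h + 1)) - X (S.sizeUpTo h)),
    Finset.sum_range_sub (fun h => X (S.sizeUpTo h)), S.sizeUpTo_length, S.sizeUpTo_zero] at hsum
  have hXn : X n = M := by simp [hX, sortedCap]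
  have hX0 : -M ≤ X 0 := by
    rw [hX, sortedCap]
    split_ifs
    · exact (abs_le.1 (hx _)).1
    · linarith
  have : L * K * (X n - X 0) ≤ L * K * (2 * M) :=
    mul_le_mul_of_nonneg_left (by linarith) (by positivity)
  linarith

/-! ### Few slices and few schemes: from likelihood ratios to the estimators -/

lemma length_le_sqrt {n : ℕ} {S : Composition n} (hS : S ∈ slicings n) :
    (S.length : ℝ) ≤ √n := by
  rcases Nat.eq_zero_or_pos n with rfl | hn
  · simp
  · have h1 : (S.length : ℝ) * √n ≤ n := by
      calc (S.length : ℝ) * √n = ∑ _h : Fin S.length, √(n : ℝ) := by simp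
        _ ≤ ∑ h, (S.blocksFun h : ℝ) := Finset.sum_le_sum fun h _ => sqrt_le_blocksFun hS h
        _ = n := sum_blocksFun_cast S
    have h2 : 0 < √(n : ℝ) := Real.sqrt_pos.2 (by exact_mod_cast hn)
    have h3 := Real.mul_self_sqrt (Nat.cast_nonneg (α := ℝ) n)
    exact le_of_mul_le_mul_right (by linarith) h2

/-- A scheme has at most ⌈√n⌉ blocks, each of size at most n. Padding the list of blocks with zeros
gives an injection into functions, because genuine blocks are positive and the padding can be
recognized. -/
lemma card_slicings_le (n : ℕ) : (slicings n).card ≤ (n + 1) ^ ⌈√(n : ℝ)⌉₊ := by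
  set m := ⌈√(n : ℝ)⌉₊ with hm
  let F : Composition n → (Fin m → Fin (n + 1)) := fun S k =>
    ⟨S.blocks.getD k 0, by
      rw [List.getD_eq_getElem?_getD]
      rcases lt_or_ge (k : ℕ) S.blocks.length with h | h
      · simpa [h, Nat.lt_succ_iff] using S.blocks_le (List.getElem_mem h)
      · simp [h]⟩
  have hinj : Set.InjOn F (slicings n) := by
    intro S hS T hT hST
    have hlen : ∀ {S : Composition n}, S ∈ slicings n → S.blocks.length ≤ m := by
      intro S hS
      rw [S.blocks_length]
      exact_mod_cast (length_le_sqrt hS).trans (Nat.le_ceil _)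
    apply Composition.ext
    apply List.ext_getElem?
    intro k
    rcases lt_or_ge k m with hk | hk
    · have := congrArg Fin.val (congrFun hST ⟨k, hk⟩)
      simp only [F, List.getD_eq_getElem?_getD] at this
      rcases lt_or_ge k S.blocks.length with h1 | h1 <;>
        rcases lt_or_ge k T.blocks.length with h2 | h2
      · simpa [h1, h2] using this
      · have h3 := S.blocks_pos (List.getElem_mem h1)
        simp [h1, h2] at this
        omega
      · have h3 := T.blocks_pos (List.getElem_mem h2)
        simp [h1, h2] at this
        omega
      · simp [h1, h2]
    · rw [List.getElem?_eq_none ((hlen hS).trans hk), List.getElem?_eq_none ((hlen hT).trans hk)]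
  calc (slicings n).card ≤ (Finset.univ : Finset (Fin m → Fin (n + 1))).card :=
        Finset.card_le_card_of_injOn F (fun _ _ => Finset.mem_univ _) hinj
    _ = _ := by simp

lemma tendsto_log_div_sqrt : Tendsto (fun n : ℕ => Real.log n / √(n : ℝ)) atTop (𝓝 0) := by
  have h := (isLittleO_log_rpow_atTop (r := 1 / 2) (by norm_num)).tendsto_div_nhds_zero
  have := h.comp tendsto_natCast_atTop_atTop
  refine this.congr fun n => ?_
  simp [Real.sqrt_eq_rpow]

lemma tendsto_inv_sqrt : Tendsto (fun n : ℕ => 1 / √(n : ℝ)) atTop (𝓝 0) :=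
  tendsto_const_nhds.div_atTop
    (Real.tendsto_sqrt_atTop.comp tendsto_natCast_atTop_atTop)

lemma one_le_length {n : ℕ} (hn : 0 < n) (S : Composition n) : (1 : ℝ) ≤ S.length := by
  exact_mod_cast S.length_pos_iff.2 hn

lemma penLogLR_eq (lam : ℝ) {n : ℕ} (x y : Fin n → ℝ) (S : Composition n) :
    penLogLR lam x y S = 2 * logLR x y S / n - lam * ((S.length : ℝ) - 1) * Real.log n / n := by
  rw [penLogLR, sub_div]

lemma penalty_nonneg {lam : ℝ} (hlam : 0 < lam) {n : ℕ} (hn : 0 < n) (S : Composition n) :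
    0 ≤ lam * ((S.length : ℝ) - 1) * Real.log n / n := by
  have h1 := one_le_length hn S
  have h2 : 0 ≤ Real.log n := Real.log_natCast_nonneg n
  have : 0 ≤ (S.length : ℝ) - 1 := by linarith
  positivity

lemma penalty_le {lam : ℝ} (hlam : 0 < lam) {n : ℕ} (hn : 0 < n) {S : Composition n}
    (hS : S ∈ slicings n) :
    lam * ((S.length : ℝ) - 1) * Real.log n / n ≤ lam * (Real.log n / √(n : ℝ)) := by
  have h1 := length_le_sqrt hS
  have h2 : 0 ≤ Real.log n := Real.log_natCast_nonneg n
  have hn' : (0 : ℝ) < n := by exact_mod_cast hn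
  have hs : 0 < √(n : ℝ) := Real.sqrt_pos.2 hn'
  have h3 := Real.mul_self_sqrt hn'.le
  rw [mul_div_assoc', div_le_div_iff₀ hn' hs]
  have h4 : ((S.length : ℝ) - 1) * √(n : ℝ) ≤ n := by nlinarith
  have h5 : 0 ≤ lam * Real.log n := by positivity
  nlinarith

/-- The likelihood ratios along the samples `x i, y i`, `i < n`, maximized over the admissible
slicings, grow at rate `ℓ / 2`. -/
def MaxLRLimit (x y : ℕ → ℝ) (ℓ : ℝ) : Prop :=
  (∀ δ > 0, ∀ᶠ n : ℕ in atTop, ∀ S ∈ slicings n,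
    2 * logLR (fun i : Fin n => x i) (fun i : Fin n => y i) S / n ≤ ℓ + δ) ∧
  ∀ δ > 0, ∀ᶠ n : ℕ in atTop, ∃ S ∈ slicings n,
    ℓ - δ ≤ 2 * logLR (fun i : Fin n => x i) (fun i : Fin n => y i) S / n

lemma MaxLRLimit.penLogLR_le {x y : ℕ → ℝ} {ℓ lam : ℝ} (h : MaxLRLimit x y ℓ) (hlam : 0 < lam)
    {δ : ℝ} (hδ : 0 < δ) : ∀ᶠ n : ℕ in atTop, ∀ S ∈ slicings n,
      penLogLR lam (fun i : Fin n => x i) (fun i : Fin n => y i) S ≤ ℓ + δ := by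
  filter_upwards [h.1 δ hδ, eventually_gt_atTop 0] with n hn hn0 S hS
  rw [penLogLR_eq]
  linarith [hn S hS, penalty_nonneg hlam hn0 S]

lemma MaxLRLimit.exists_le_penLogLR {x y : ℕ → ℝ} {ℓ lam : ℝ} (h : MaxLRLimit x y ℓ)
    (hlam : 0 < lam) {δ : ℝ} (hδ : 0 < δ) : ∀ᶠ n : ℕ in atTop, ∃ S ∈ slicings n,
      ℓ - δ ≤ penLogLR lam (fun i : Fin n => x i) (fun i : Fin n => y i) S := by
  have ht : Tendsto (fun n : ℕ => lam * (Real.log n / √(n : ℝ))) atTop (𝓝 0) := by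
    simpa using tendsto_log_div_sqrt.const_mul lam
  filter_upwards [h.2 (δ / 2) (by positivity), eventually_gt_atTop 0,
    ht.eventually_lt_const (half_pos hδ)] with n ⟨S, hS, hn⟩ hn0 hn1
  refine ⟨S, hS, ?_⟩
  rw [penLogLR_eq]
  linarith [penalty_le hlam hn0 hS]

lemma MaxLRLimit.tendsto_GmCond {x y : ℕ → ℝ} {ℓ lam : ℝ} (h : MaxLRLimit x y ℓ)
    (hlam : 0 < lam) :
    Tendsto (fun n : ℕ => GmCond lam (fun i : Fin n => x i) (fun i : Fin n => y i)) atTop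
      (𝓝 (1 - Real.exp (-ℓ))) := by
  have key : Tendsto (fun n : ℕ => maxPenLogLR lam (fun i : Fin n => x i) (fun i : Fin n => y i))
      atTop (𝓝 ℓ) := by
    rw [Metric.tendsto_atTop']
    intro ε hε
    obtain ⟨N, hN⟩ := ((h.penLogLR_le hlam (half_pos hε)).and
      (h.exists_le_penLogLR hlam (half_pos hε))).exists_forall_of_atTop
    refine ⟨N, fun n hn => ?_⟩
    obtain ⟨h1, S, hS, h2⟩ := hN n hn.le
    have a1 : maxPenLogLR lam (fun i : Fin n => x i) (fun i : Fin n => y i) ≤ ℓ + ε / 2 :=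
      Finset.sup'_le _ _ h1
    have a2 : ℓ - ε / 2 ≤ maxPenLogLR lam (fun i : Fin n => x i) (fun i : Fin n => y i) :=
      h2.trans (Finset.le_sup' (penLogLR lam _ _) hS)
    rw [Real.dist_eq, abs_lt]
    constructor <;> linarith
  exact ((Real.continuous_exp.tendsto _).comp key.neg).const_sub 1

/-- This is 2 / n times the logarithm of the bound on the number of schemes: the entropy of the
family vanishes on the exponential scale. -/
lemma tendsto_two_mul_ceil_sqrt_mul_log :
    Tendsto (fun n : ℕ => 2 * (⌈√(n : ℝ)⌉₊ * Real.log (n + 1)) / n) atTop (𝓝 0) := by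
  have h8 : Tendsto (fun n : ℕ => 8 * (Real.log n / √(n : ℝ))) atTop (𝓝 0) := by
    simpa using tendsto_log_div_sqrt.const_mul 8
  refine squeeze_zero' (Eventually.of_forall fun n => ?_) ?_ h8
  · have : 0 ≤ Real.log ((n : ℝ) + 1) := Real.log_nonneg (by linarith [Nat.cast_nonneg (α := ℝ) n])
    positivity
  · filter_upwards [eventually_ge_atTop 2] with n hn
    have hn2 : (2 : ℝ) ≤ n := by exact_mod_cast hn
    have hs : 1 ≤ √(n : ℝ) := Real.one_le_sqrt.2 (by linarith)
    have h3 := Real.mul_self_sqrt (show (0 : ℝ) ≤ n by linarith)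
    have hc : (⌈√(n : ℝ)⌉₊ : ℝ) ≤ 2 * √(n : ℝ) := by
      linarith [Nat.ceil_lt_add_one (Real.sqrt_nonneg (n : ℝ))]
    have hl : Real.log ((n : ℝ) + 1) ≤ 2 * Real.log n := by
      have h := Real.log_le_log (x := (n : ℝ) + 1) (y := (n : ℝ) ^ 2) (by linarith) (by nlinarith)
      simpa [Real.log_pow] using h
    have hl0 : 0 ≤ Real.log ((n : ℝ) + 1) := Real.log_nonneg (by linarith)
    have hm : (⌈√(n : ℝ)⌉₊ : ℝ) * Real.log (n + 1) ≤ 2 * √(n : ℝ) * (2 * Real.log n) :=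
      mul_le_mul hc hl hl0 (by positivity)
    rw [mul_div_assoc', div_le_div_iff₀ (by linarith) (by linarith)]
    calc 2 * (⌈√(n : ℝ)⌉₊ * Real.log (n + 1)) * √(n : ℝ)
        ≤ 2 * (2 * √(n : ℝ) * (2 * Real.log n)) * √(n : ℝ) := by gcongr
      _ = 8 * Real.log n * (√(n : ℝ) * √(n : ℝ)) := by ring
      _ = _ := by rw [h3]

lemma exp_penLogLR {lam : ℝ} {n : ℕ} (hn : 0 < n) (x y : Fin n → ℝ) (S : Composition n) :
    Real.exp ((n : ℝ) / 2 * penLogLR lam x y S)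
      = Real.exp (logLR x y S) * (n : ℝ) ^ (-(lam * ((S.length : ℝ) - 1) / 2)) := by
  have hn' : (0 : ℝ) < n := by exact_mod_cast hn
  rw [Real.rpow_def_of_pos hn', ← Real.exp_add, penLogLR]
  congr 1
  field_simp
  ring

lemma MaxLRLimit.tendsto_GtCond {x y : ℕ → ℝ} {ℓ lam : ℝ} (h : MaxLRLimit x y ℓ)
    (hlam : 0 < lam) :
    Tendsto (fun n : ℕ => GtCond lam (fun i : Fin n => x i) (fun i : Fin n => y i)) atTop
      (𝓝 (1 - Real.exp (-ℓ))) := by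
  have hbound : ∀ ε > 0, ∀ᶠ n : ℕ in atTop,
      Real.exp (n / 2 * (ℓ - ε)) ≤ bayesFactor lam (fun i : Fin n => x i) (fun i : Fin n => y i) ∧
      bayesFactor lam (fun i : Fin n => x i) (fun i : Fin n => y i)
        ≤ Real.exp (n / 2 * (ℓ + ε)) := by
    intro ε hε
    filter_upwards [h.1 ε hε, h.exists_le_penLogLR hlam (half_pos hε), eventually_gt_atTop 0,
      tendsto_two_mul_ceil_sqrt_mul_log.eventually_lt_const (half_pos hε)] with n h1 h2 hn0 h3
    have hn' : (0 : ℝ) < n := by exact_mod_cast hn0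
    set w : Composition n → ℝ := fun S => (n : ℝ) ^ (-(lam * ((S.length : ℝ) - 1) / 2)) with hw
    have hwpos : ∀ S, 0 < w S := fun S => Real.rpow_pos_of_pos hn' _
    have hW : 0 < ∑ S ∈ slicings n, w S :=
      Finset.sum_pos (fun S _ => hwpos S) (slicings_nonempty n)
    constructor
    -- Lower bound: keep one nearly optimal scheme in the numerator and bound the total weight by
    -- the number of schemes.
    · obtain ⟨S, hS, h2⟩ := h2
      have hw1 : ∀ S, w S ≤ 1 := by
        intro S
        refine Real.rpow_le_one_of_one_le_of_nonpos (by exact_mod_cast hn0) ?_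
        have : 0 ≤ lam * ((S.length : ℝ) - 1) :=
          mul_nonneg hlam.le (by linarith [one_le_length hn0 S])
        linarith
      have hWle : ∑ S ∈ slicings n, w S ≤ Real.exp (⌈√(n : ℝ)⌉₊ * Real.log (n + 1)) := by
        calc ∑ S ∈ slicings n, w S ≤ ∑ S ∈ slicings n, 1 := Finset.sum_le_sum fun S _ => hw1 S
          _ = ((slicings n).card : ℝ) := by simp
          _ ≤ ((n : ℝ) + 1) ^ ⌈√(n : ℝ)⌉₊ := by exact_mod_cast card_slicings_le n
          _ = _ := by
            rw [← Real.log_pow, Real.exp_log (by positivity)]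
      rw [bayesFactor, ← div_eq_inv_mul, le_div_iff₀ hW]
      have h4 := (div_lt_iff₀ hn').1 h3
      calc Real.exp (n / 2 * (ℓ - ε)) * ∑ S ∈ slicings n, w S
          ≤ Real.exp (n / 2 * (ℓ - ε)) * Real.exp (⌈√(n : ℝ)⌉₊ * Real.log (n + 1)) := by gcongr
        _ = Real.exp (n / 2 * (ℓ - ε) + ⌈√(n : ℝ)⌉₊ * Real.log (n + 1)) := by rw [Real.exp_add]
        _ ≤ Real.exp (n / 2 * penLogLR lam (fun i : Fin n => x i) (fun i : Fin n => y i) S) := by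
            refine Real.exp_le_exp.2 ?_
            nlinarith
        _ ≤ _ := Finset.single_le_sum (f := fun S => Real.exp (n / 2 *
            penLogLR lam (fun i : Fin n => x i) (fun i : Fin n => y i) S))
            (fun S _ => (Real.exp_pos _).le) hS
    -- Upper bound: the penalty is exactly the weight, so this is a weighted mean of unpenalized
    -- likelihood ratios and is bounded termwise.
    · rw [bayesFactor, ← div_eq_inv_mul, div_le_iff₀ hW, Finset.mul_sum]
      refine Finset.sum_le_sum fun S hS => ?_
      rw [exp_penLogLR hn0]
      refine mul_le_mul_of_nonneg_right (Real.exp_le_exp.2 ?_) (hwpos S).le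
      have := (div_le_iff₀ hn').1 (h1 S hS)
      linarith
  have key : Tendsto (fun n : ℕ =>
      Real.log (bayesFactor lam (fun i : Fin n => x i) (fun i : Fin n => y i)) * (-2 / (n : ℝ)))
      atTop (𝓝 (-ℓ)) := by
    rw [Metric.tendsto_atTop']
    intro ε hε
    obtain ⟨N, hN⟩ := (hbound (ε / 2) (half_pos hε)).exists_forall_of_atTop
    refine ⟨N, fun n hn => ?_⟩
    obtain ⟨h1, h2⟩ := hN n hn.le
    have hn' : (0 : ℝ) < n := by exact_mod_cast (Nat.zero_le N).trans_lt hn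
    have hpos := (Real.exp_pos _).trans_le h1
    rw [← Real.le_log_iff_exp_le hpos] at h1
    rw [← Real.log_le_iff_le_exp hpos] at h2
    set b := Real.log (bayesFactor lam (fun i : Fin n => x i) (fun i : Fin n => y i))
    have e : b * (-2 / (n : ℝ)) = - (b / (n / 2)) := by field_simp
    have h1' : ℓ - ε / 2 ≤ b / (n / 2) := (le_div_iff₀ (by positivity)).2 (by linarith)
    have h2' : b / (n / 2) ≤ ℓ + ε / 2 := (div_le_iff₀ (by positivity)).2 (by linarith)
    rw [Real.dist_eq, e, abs_lt]
    constructor <;> linarith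
  refine (((Real.continuous_exp.tendsto _).comp key).const_sub 1).congr' ?_
  filter_upwards [hbound 1 one_pos] with n hn
  rw [GtCond, Real.rpow_def_of_pos ((Real.exp_pos _).trans_le hn.1)]
  rfl

/-! ### Both bounds combined along a fixed sequence of observations -/

/-- Deterministic form of the consistency statement: the limit of the maximal likelihood ratio
for sequences that satisfy window bounds and laws of large numbers. -/
lemma maxLRLimit_of_window {x y : ℕ → ℝ} {m v : ℝ → ℝ} {M B v₀ V Λ : ℝ}
    (hx : Function.Injective x) (hxM : ∀ i, |x i| ≤ M) (hyB : ∀ i, |y i| ≤ B)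
    (hv₀ : 0 < v₀) (hv : ∀ i, v₀ ≤ v (x i))
    (hm : ∀ δ > 0, ∀ᶠ n : ℕ in atTop,
      WindowBound (fun i : Fin n => x i) (fun i : Fin n => y i - m (x i)) δ)
    (hq : ∀ δ > 0, ∀ᶠ n : ℕ in atTop,
      WindowBound (fun i : Fin n => x i)
        (fun i : Fin n => y i ^ 2 - (m (x i) ^ 2 + v (x i))) δ)
    (hV : 0 < V)
    (hVar : Tendsto (fun n : ℕ => sampleVar (fun i : Fin n => y i)) atTop (𝓝 V))
    (hΛ : Tendsto (fun n : ℕ => (∑ i ∈ Finset.range n, Real.log (v (x i))) / n) atTop (𝓝 Λ))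
    (hlin : ∀ η > 0, ∃ φ c : ℝ → ℝ, Continuous φ ∧ Continuous c ∧ (∀ u, 0 < φ u) ∧
      ∀ᶠ n : ℕ in atTop, (∑ i ∈ Finset.range n, logLin φ c (x i) (y i)) / n ≤ Λ + η) :
    MaxLRLimit x y (Real.log V - Λ) := by
  have hB : 0 ≤ B := (abs_nonneg _).trans (hyB 0)
  have hM : 0 ≤ M := (abs_nonneg _).trans (hxM 0)
  have hlogV := hVar.log hV.ne'
  have hinj : ∀ n : ℕ, Function.Injective (fun i : Fin n => x i) :=
    fun n => hx.comp Fin.val_injective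
  constructor
  · intro δ hδ
    obtain ⟨ε, hε0, hε1, hεδ⟩ : ∃ ε : ℝ, 0 < ε ∧ ε < 1 ∧ - Real.log (1 - ε) < δ / 3 := by
      have hc : Tendsto (fun ε : ℝ => - Real.log (1 - ε)) (𝓝[>] 0) (𝓝 0) := by
        have : ContinuousAt (fun ε : ℝ => - Real.log (1 - ε)) 0 :=
          ((continuousAt_const.sub continuousAt_id).log (by simp)).neg
        simpa [ContinuousAt] using this.tendsto.mono_left nhdsWithin_le_nhds
      obtain ⟨ε, h1, h2, h3⟩ := ((hc.eventually_lt_const (show (0 : ℝ) < δ / 3 by positivity)).and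
        (Ioo_mem_nhdsGT (zero_lt_one' ℝ))).exists
      exact ⟨ε, h2, h3, h1⟩
    set d := ε * v₀ / (2 * (1 + 6 * B)) with hd
    have hd0 : 0 < d := by positivity
    have hdε : (1 + 6 * B) * (2 * d) ≤ ε * v₀ := by
      rw [hd]; field_simp; rfl
    filter_upwards [hm d hd0, hq d hd0, eventually_gt_atTop 0,
      hlogV.eventually_lt_const (show Real.log V < Real.log V + δ / 3 by linarith),
      hΛ.eventually_const_lt (show Λ - δ / 3 < Λ by linarith)] with n h1 h2 hn0 h3 h4 S hS
    have hn' : (0 : ℝ) < n := by exact_mod_cast hn0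
    have key := two_mul_logLR_le (hinj n) (fun i => hyB i) hd0.le h1 h2 hv₀
      (fun i => hv i) hε1 hε0.le hdε hS
    rw [Fin.sum_univ_eq_sum_range (fun i => Real.log (v (x i)))] at key
    have h5 := (lt_div_iff₀ hn').1 h4
    rw [div_le_iff₀ hn']
    nlinarith
  · intro δ hδ
    obtain ⟨φ, c, hφ, hc, hφ0, hlin⟩ := hlin (δ / 4) (by positivity)
    obtain ⟨L, hL, hmod⟩ := exists_logLin_modulus hφ hc hφ0 M hB (η := δ / 4) (by positivity)
    -- A crude ε = 1/2 suffices here: the window bounds only serve to make the residual variances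
    -- positive.
    set d := (1 / 2) * v₀ / (2 * (1 + 6 * B)) with hd
    have hd0 : 0 < d := by positivity
    have hdε : (1 + 6 * B) * (2 * d) ≤ (1 / 2) * v₀ := by
      rw [hd]; field_simp; rfl
    have hsmall : Tendsto (fun n : ℕ => (L * 4 * (2 * M)) * (1 / √(n : ℝ))) atTop (𝓝 0) := by
      simpa using tendsto_inv_sqrt.const_mul (L * 4 * (2 * M))
    filter_upwards [hm d hd0, hq d hd0, eventually_gt_atTop 0, hlin,
      hlogV.eventually_const_lt (show Real.log V - δ / 4 < Real.log V by linarith),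
      hsmall.eventually_lt_const (show (0 : ℝ) < δ / 4 by positivity)] with n h1 h2 hn0 h3 h4 h5
    have hn' : (0 : ℝ) < n := by exact_mod_cast hn0
    have hs1 : 1 ≤ √(n : ℝ) := Real.one_le_sqrt.2 (by exact_mod_cast hn0)
    have hs2 := Real.mul_self_sqrt hn'.le
    have hmpos : 0 < ⌈√(n : ℝ)⌉₊ := Nat.ceil_pos.2 (by linarith)
    have hmle : ⌈√(n : ℝ)⌉₊ ≤ n := Nat.ceil_le.2 (by nlinarith)
    set S := equalBlocks n ⌈√(n : ℝ)⌉₊ hmpos hmle with hS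
    have hSm : S ∈ slicings n := mem_slicings.2 fun k hk => (mem_equalBlocks hk).1
    refine ⟨S, hSm, ?_⟩
    have hpos := fun h => (blocksFun_mul_log_sliceResidVar_ge (hinj n) (fun i => hyB i) hd0.le h1 h2
      hv₀ (fun i => hv i) (by norm_num : (1 / 2 : ℝ) < 1) (by norm_num) hdε hSm h).1
    have key := sum_log_sliceResidVar_le hM (fun i : Fin n => hxM i) (fun i : Fin n => hyB i) hφ0 hL
      hmod S (fun k hk => (mem_equalBlocks hk).2) hpos
    rw [Fin.sum_univ_eq_sum_range (fun i => logLin φ c (x i) (y i))] at key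
    have e : 2 * logLR (fun i : Fin n => x i) (fun i : Fin n => y i) S
        = n * Real.log (sampleVar (fun i : Fin n => y i)) - ∑ h, S.blocksFun h *
          Real.log (sliceResidVar (fun i : Fin n => x i) (fun i : Fin n => y i) S h) := by
      rw [logLR, mul_sub, Finset.mul_sum]
      congr 1
      · ring
      · exact Finset.sum_congr rfl fun h _ => by ring
    have h3' := (div_le_iff₀ hn').1 h3
    -- Blocks have at most 2⌈√n⌉ ≤ 4√n points, so the telescoped widths contribute O(√n) = o(n).
    have hc2 : ((2 * ⌈√(n : ℝ)⌉₊ : ℕ) : ℝ) ≤ 4 * √(n : ℝ) := by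
      push_cast
      linarith [Nat.ceil_lt_add_one (Real.sqrt_nonneg (n : ℝ))]
    have h6 : L * ((2 * ⌈√(n : ℝ)⌉₊ : ℕ) : ℝ) * (2 * M) ≤ n * (δ / 4) := by
      calc L * ((2 * ⌈√(n : ℝ)⌉₊ : ℕ) : ℝ) * (2 * M) ≤ L * (4 * √(n : ℝ)) * (2 * M) := by gcongr
        _ = n * ((L * 4 * (2 * M)) * (1 / √(n : ℝ))) := by
            have : (n : ℝ) * (1 / √(n : ℝ)) = √(n : ℝ) := by
              rw [mul_one_div, div_eq_iff (by linarith), hs2]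
            linear_combination (- L * 4 * (2 * M)) * this
        _ ≤ n * (δ / 4) := mul_le_mul_of_nonneg_left h5.le hn'.le
    rw [le_div_iff₀ hn', e]
    have h7 : n * (Real.log V - δ / 4) ≤ n * Real.log (sampleVar (fun i : Fin n => y i)) :=
      mul_le_mul_of_nonneg_left h4.le hn'.le
    linarith

/-! ### Exponential inequality and uniform law of large numbers over windows -/

/-- The tilted exponential of a function over a window in the first coordinate. -/
noncomputable def windowExp (g : ℝ × ℝ → ℝ) (s c : ℝ) (p : ℝ × ℝ) (z : ℝ × ℝ) : ℝ :=
  if p.1 ≤ z.1 ∧ z.1 ≤ p.2 then s * g z - (s * c) ^ 2 else 0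

lemma measurable_windowExp {g : ℝ × ℝ → ℝ} (hg : Measurable g) (s c : ℝ) :
    Measurable (fun q : (ℝ × ℝ) × (ℝ × ℝ) => windowExp g s c q.1 q.2) := by
  unfold windowExp
  refine Measurable.ite ?_ (by fun_prop) measurable_const
  have h1 : Measurable fun q : (ℝ × ℝ) × (ℝ × ℝ) => q.2.1 := by fun_prop
  exact (measurableSet_le (measurable_fst.comp measurable_fst) h1).inter
    (measurableSet_le h1 (measurable_snd.comp measurable_fst))

/-- From e^u ≤ 1 + u + u² ≤ e^(κ²) + u. The bound is affine in u with constant term 1, so a centred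
u gives an exponential moment of at most 1. -/
lemma exp_sub_sq_le {u κ : ℝ} (hκ : κ ≤ 1) (hu : |u| ≤ κ) :
    Real.exp (u - κ ^ 2) ≤ 1 + Real.exp (-κ ^ 2) * u := by
  have h1 := Real.abs_exp_sub_one_sub_id_le (hu.trans hκ)
  have h2 := (abs_le.1 h1).2
  have h3 : u ^ 2 ≤ κ ^ 2 := by
    rw [← sq_abs u]
    exact pow_le_pow_left₀ (abs_nonneg _) hu 2
  have h4 := Real.add_one_le_exp (κ ^ 2)
  have h5 : Real.exp (-κ ^ 2) * Real.exp (κ ^ 2) = 1 := by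
    rw [← Real.exp_add]; simp
  have h6 := Real.exp_pos (-κ ^ 2)
  have h7 : Real.exp (u - κ ^ 2) = Real.exp (-κ ^ 2) * Real.exp u := by
    rw [← Real.exp_add]; ring_nf
  rw [h7]
  calc Real.exp (-κ ^ 2) * Real.exp u ≤ Real.exp (-κ ^ 2) * (Real.exp (κ ^ 2) + u) := by
        refine mul_le_mul_of_nonneg_left ?_ h6.le
        linarith
    _ = _ := by rw [mul_add, h5]

/-- Outside the window the integrand is 1; inside, the affine majorant of `exp_sub_sq_le` applies,
and its linear part integrates to zero by `hzero`. No property of the window's probability is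
needed. -/
lemma lintegral_exp_windowExp_le_one {π : Measure (ℝ × ℝ)} [IsProbabilityMeasure π]
    {g : ℝ × ℝ → ℝ} (hg : Measurable g) {s c : ℝ} (hs : 0 ≤ s) (hsc : s * c ≤ 1)
    (hc : ∀ᵐ z ∂π, |g z| ≤ c)
    (hzero : ∀ J : Set ℝ, MeasurableSet J → ∫ z in Prod.fst ⁻¹' J, g z ∂π = 0) (p : ℝ × ℝ) :
    ∫⁻ z, ENNReal.ofReal (Real.exp (windowExp g s c p z)) ∂π ≤ 1 := by
  set W : Set (ℝ × ℝ) := Prod.fst ⁻¹' Set.Icc p.1 p.2 with hW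
  have hWm : MeasurableSet W := measurable_fst measurableSet_Icc
  have hgi : Integrable g π := Integrable.of_bound hg.aestronglyMeasurable c hc
  set f : ℝ × ℝ → ℝ := fun z => 1 + Real.exp (-(s * c) ^ 2) * s * W.indicator g z with hf
  have hle : ∀ᵐ z ∂π, Real.exp (windowExp g s c p z) ≤ f z := by
    filter_upwards [hc] with z hz
    by_cases h : z ∈ W
    · have h' : p.1 ≤ z.1 ∧ z.1 ≤ p.2 := h
      simp only [windowExp, if_pos h', hf, Set.indicator_of_mem h]
      refine (exp_sub_sq_le hsc ?_).trans (le_of_eq (by ring))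
      rw [abs_mul, abs_of_nonneg hs]
      exact mul_le_mul_of_nonneg_left hz hs
    · have h' : ¬ (p.1 ≤ z.1 ∧ z.1 ≤ p.2) := h
      simp [windowExp, if_neg h', hf, Set.indicator_of_notMem h]
  have hfi : Integrable f π :=
    (integrable_const 1).add ((hgi.indicator hWm).const_mul _)
  have hf0 : 0 ≤ᵐ[π] f := hle.mono fun z hz => (Real.exp_pos _).le.trans hz
  calc _ ≤ ∫⁻ z, ENNReal.ofReal (f z) ∂π :=
        lintegral_mono_ae (hle.mono fun z hz => ENNReal.ofReal_le_ofReal hz)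
    _ = ENNReal.ofReal (∫ z, f z ∂π) := (ofReal_integral_eq_lintegral_ofReal hfi hf0).symm
    _ = 1 := by
        rw [hf, integral_add (integrable_const 1) ((hgi.indicator hWm).const_mul _),
          integral_const_mul, integral_indicator hWm, hzero _ measurableSet_Icc]
        simp

section Sample

variable {Ω : Type*} [MeasurableSpace Ω] {P : Measure Ω} {π : Measure (ℝ × ℝ)}
  {Z : ℕ → Ω → ℝ × ℝ}

lemma ae_law (hZm : ∀ i, Measurable (Z i)) (hlaw : ∀ i, P.map (Z i) = π) {p : ℝ × ℝ → Prop}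
    (hp : ∀ᵐ z ∂π, p z) : ∀ᵐ ω ∂P, ∀ i, p (Z i ω) := by
  rw [ae_all_iff]
  intro i
  rw [← hlaw i] at hp
  exact ae_of_ae_map (hZm i).aemeasurable hp

/-- The strong law of large numbers for functions of the observations. -/
lemma ae_tendsto_average (hZm : ∀ i, Measurable (Z i)) (hind : iIndepFun Z P)
    (hlaw : ∀ i, P.map (Z i) = π) {f : ℝ × ℝ → ℝ} (hf : Measurable f) (hfi : Integrable f π) :
    ∀ᵐ ω ∂P, Tendsto (fun n : ℕ => (∑ i ∈ Finset.range n, f (Z i ω)) / n) atTop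
      (𝓝 (∫ z, f z ∂π)) := by
  have h := strong_law_ae_real (μ := P) (fun i ω => f (Z i ω))
    (by
      rw [← hlaw 0] at hfi
      exact hfi.comp_measurable (hZm 0))
    (fun i j hij => (hind.indepFun hij).comp hf hf)
    (fun i => (IdentDistrib.mk (hZm i).aemeasurable (hZm 0).aemeasurable
      (by rw [hlaw, hlaw])).comp hf)
  have e : ∫ ω, f (Z 0 ω) ∂P = ∫ z, f z ∂π := by
    rw [← hlaw 0, integral_map (hZm 0).aemeasurable hf.aestronglyMeasurable]
  rwa [e] at h

lemma lintegral_prod_le_one (hZm : ∀ i, Measurable (Z i)) (hind : iIndepFun Z P)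
    (hlaw : ∀ i, P.map (Z i) = π) {k : ℝ × ℝ → ENNReal} (hk : Measurable k)
    (hk1 : ∫⁻ z, k z ∂π ≤ 1) (T : Finset ℕ) : ∫⁻ ω, ∏ i ∈ T, k (Z i ω) ∂P ≤ 1 := by
  have := hind.isProbabilityMeasure
  rw [lintegral_prod_eq_prod_lintegral_of_indepFun T (fun i ω => k (Z i ω))
    (hind.comp (fun _ => k) fun _ => hk) (fun i => hk.comp (hZm i))]
  refine Finset.prod_le_one' fun i _ => ?_
  rwa [← lintegral_map hk (hZm i), hlaw i]

variable [IsProbabilityMeasure P]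

/-- The first coordinates of two observations may serve as parameters of a product over the other
observations. -/
lemma lintegral_prod_param_le_one (hZm : ∀ i, Measurable (Z i)) (hind : iIndepFun Z P)
    (hlaw : ∀ i, P.map (Z i) = π) {k : ℝ × ℝ → ℝ × ℝ → ENNReal}
    (hk : Measurable (Function.uncurry k)) (hk1 : ∀ p, ∫⁻ z, k p z ∂π ≤ 1)
    (a b : ℕ) (T : Finset ℕ) (haT : a ∉ T) (hbT : b ∉ T) :
    ∫⁻ ω, ∏ i ∈ T, k ((Z a ω).1, (Z b ω).1) (Z i ω) ∂P ≤ 1 := by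
  have hdisj : Disjoint ({a, b} : Finset ℕ) T := by
    rw [Finset.disjoint_left]
    intro i hi
    simp only [Finset.mem_insert, Finset.mem_singleton] at hi
    rcases hi with rfl | rfl <;> assumption
  have hm1 : Measurable (fun ω => ((Z a ω).1, (Z b ω).1)) :=
    (measurable_fst.comp (hZm a)).prodMk (measurable_fst.comp (hZm b))
  have hm2 : Measurable (fun ω (i : T) => Z i ω) := measurable_pi_lambda _ fun i => hZm i
  -- The window endpoints are independent of the observations indexed by T, so Fubini allows them to
  -- be frozen. The case a = b is included.
  have hI : IndepFun (fun ω => ((Z a ω).1, (Z b ω).1)) (fun ω (i : T) => Z i ω) P := by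
    have ha : a ∈ ({a, b} : Finset ℕ) := by simp
    have hb : b ∈ ({a, b} : Finset ℕ) := by simp
    have hφ : Measurable (fun r : ({a, b} : Finset ℕ) → ℝ × ℝ =>
        ((r ⟨a, ha⟩).1, (r ⟨b, hb⟩).1)) :=
      (measurable_fst.comp (measurable_pi_apply _)).prodMk
        (measurable_fst.comp (measurable_pi_apply _))
    exact (hind.indepFun_finset {a, b} T hdisj hZm).comp hφ measurable_id
  set F : (ℝ × ℝ) × (T → ℝ × ℝ) → ENNReal := fun q => ∏ i : T, k q.1 (q.2 i) with hFdef
  have hF : Measurable F := Finset.measurable_prod _ fun i _ =>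
    hk.comp (measurable_fst.prodMk ((measurable_pi_apply i).comp measurable_snd))
  have hFT : ∀ p ω, F (p, fun i : T => Z i ω) = ∏ i ∈ T, k p (Z i ω) := fun p ω =>
    Finset.prod_coe_sort T fun i => k p (Z i ω)
  have hprob : IsProbabilityMeasure (P.map fun ω => ((Z a ω).1, (Z b ω).1)) :=
    Measure.isProbabilityMeasure_map hm1.aemeasurable
  simp only [← hFT]
  rw [← lintegral_map hF (hm1.prodMk hm2),
    (indepFun_iff_map_prod_eq_prod_map_map hm1.aemeasurable hm2.aemeasurable).1 hI,
    lintegral_prod _ hF.aemeasurable]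
  refine (lintegral_mono (g := fun _ => 1) fun p => ?_).trans (by simp)
  have hFp : Measurable (fun r : T → ℝ × ℝ => F (p, r)) := hF.comp measurable_prodMk_left
  calc ∫⁻ r, F (p, r) ∂(P.map fun ω (i : T) => Z i ω)
      = ∫⁻ ω, F (p, fun i : T => Z i ω) ∂P := lintegral_map hFp hm2
    _ = ∫⁻ ω, ∏ i ∈ T, k p (Z i ω) ∂P := by simp only [hFT]
    _ ≤ 1 := lintegral_prod_le_one hZm hind hlaw (hk.comp measurable_prodMk_left) (hk1 p) T

variable [IsProbabilityMeasure π]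

/-- Chernoff's bound. The observations a and b define the window and are not independent of it;
their factors are at most e each and are taken out, which produces the 2 in the exponent. -/
lemma measure_sum_windowExp_ge_le (hZm : ∀ i, Measurable (Z i)) (hind : iIndepFun Z P)
    (hlaw : ∀ i, P.map (Z i) = π)
    {g : ℝ × ℝ → ℝ} (hg : Measurable g) {s c : ℝ} (hs : 0 ≤ s) (hsc : s * c ≤ 1)
    (hc : ∀ᵐ z ∂π, |g z| ≤ c)
    (hzero : ∀ J : Set ℝ, MeasurableSet J → ∫ z in Prod.fst ⁻¹' J, g z ∂π = 0)
    {a b n : ℕ} (ha : a < n) (hb : b < n) (t : ℝ) :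
    P {ω | t ≤ ∑ i ∈ Finset.range n, windowExp g s c ((Z a ω).1, (Z b ω).1) (Z i ω)}
      ≤ ENNReal.ofReal (Real.exp (2 - t)) := by
  set K : ℕ → Ω → ENNReal := fun i ω => ENNReal.ofReal (Real.exp
    (windowExp g s c ((Z a ω).1, (Z b ω).1) (Z i ω))) with hK
  have hKm : ∀ i, Measurable (K i) := fun i =>
    (Real.measurable_exp.comp ((measurable_windowExp hg s c).comp
      (((measurable_fst.comp (hZm a)).prodMk (measurable_fst.comp (hZm b))).prodMk
        (hZm i)))).ennreal_ofReal
  have hsub : ({a, b} : Finset ℕ) ⊆ Finset.range n := by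
    intro i hi
    simp only [Finset.mem_insert, Finset.mem_singleton] at hi
    rcases hi with rfl | rfl <;> simpa
  set T := Finset.range n \ {a, b} with hT
  have hprod : ∀ᵐ ω ∂P, ∏ i ∈ Finset.range n, K i ω
      ≤ (∏ i ∈ T, K i ω) * ENNReal.ofReal (Real.exp 2) := by
    filter_upwards [ae_law hZm hlaw hc] with ω hω
    rw [← Finset.prod_sdiff hsub]
    refine mul_le_mul_right ?_ _
    have hle : ∀ i, K i ω ≤ ENNReal.ofReal (Real.exp 1) := by
      intro i
      refine ENNReal.ofReal_le_ofReal (Real.exp_le_exp.2 ?_)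
      unfold windowExp
      split_ifs
      · have := mul_le_mul_of_nonneg_left ((le_abs_self _).trans (hω i)) hs
        nlinarith [sq_nonneg (s * c)]
      · norm_num
    have h1 : (1 : ENNReal) ≤ ENNReal.ofReal (Real.exp 1) := by
      rw [ENNReal.one_le_ofReal]
      exact Real.one_le_exp (by norm_num)
    calc ∏ i ∈ ({a, b} : Finset ℕ), K i ω
        ≤ ENNReal.ofReal (Real.exp 1) ^ ({a, b} : Finset ℕ).card :=
          Finset.prod_le_pow_card _ _ _ fun i _ => hle i
      _ ≤ ENNReal.ofReal (Real.exp 1) ^ 2 := pow_le_pow_right₀ h1 Finset.card_le_two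
      _ = ENNReal.ofReal (Real.exp 2) := by
          rw [← ENNReal.ofReal_pow (Real.exp_pos _).le, ← Real.exp_nat_mul]
          norm_num
  have hint : ∫⁻ ω, ∏ i ∈ Finset.range n, K i ω ∂P ≤ ENNReal.ofReal (Real.exp 2) := by
    refine (lintegral_mono_ae hprod).trans ?_
    rw [lintegral_mul_const _ (Finset.measurable_prod _ fun i _ => hKm i)]
    have := lintegral_prod_param_le_one hZm hind hlaw
      (k := fun p z => ENNReal.ofReal (Real.exp (windowExp g s c p z)))
      (Real.measurable_exp.comp (measurable_windowExp hg s c)).ennreal_ofReal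
      (lintegral_exp_windowExp_le_one hg hs hsc hc hzero) a b T (by simp [hT]) (by simp [hT])
    calc _ ≤ 1 * ENNReal.ofReal (Real.exp 2) := by gcongr
      _ = _ := one_mul _
  have hexp : ∀ ω, ∏ i ∈ Finset.range n, K i ω = ENNReal.ofReal (Real.exp
      (∑ i ∈ Finset.range n, windowExp g s c ((Z a ω).1, (Z b ω).1) (Z i ω))) := by
    intro ω
    rw [Real.exp_sum, ENNReal.ofReal_prod_of_nonneg fun i _ => (Real.exp_pos _).le]
  have hmarkov := mul_meas_ge_le_lintegral₀ (μ := P)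
    (f := fun ω => ∏ i ∈ Finset.range n, K i ω)
    (Finset.measurable_prod _ fun i _ => hKm i).aemeasurable (ENNReal.ofReal (Real.exp t))
  have hset : {ω | ENNReal.ofReal (Real.exp t) ≤ ∏ i ∈ Finset.range n, K i ω}
      = {ω | t ≤ ∑ i ∈ Finset.range n, windowExp g s c ((Z a ω).1, (Z b ω).1) (Z i ω)} := by
    ext ω
    simp only [Set.mem_ofPred_eq]
    rw [hexp, ENNReal.ofReal_le_ofReal_iff (Real.exp_pos _).le, Real.exp_le_exp]
  rw [hset] at hmarkov
  have h0 : ENNReal.ofReal (Real.exp t) ≠ 0 := by simp [Real.exp_pos]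
  calc _ = ENNReal.ofReal (Real.exp (-t)) * (ENNReal.ofReal (Real.exp t) *
        P {ω | t ≤ ∑ i ∈ Finset.range n,
          windowExp g s c ((Z a ω).1, (Z b ω).1) (Z i ω)}) := by
        rw [← mul_assoc, ← ENNReal.ofReal_mul (Real.exp_pos _).le, ← Real.exp_add]
        simp
    _ ≤ ENNReal.ofReal (Real.exp (-t)) * ENNReal.ofReal (Real.exp 2) := by
        gcongr
        exact hmarkov.trans hint
    _ = _ := by
        rw [← ENNReal.ofReal_mul (Real.exp_pos _).le, ← Real.exp_add]
        congr 2
        ring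

lemma summable_sq_mul_exp_neg_sqrt {κ : ℝ} (hκ : 0 < κ) :
    Summable (fun n : ℕ => (n : ℝ) ^ 2 * Real.exp (2 - κ * √(n : ℝ))) := by
  -- The power -8 of √n is n⁻⁴, which leaves n⁻² after multiplication by n².
  have h1 := (isLittleO_exp_neg_mul_rpow_atTop hκ (-8)).comp_tendsto
    (Real.tendsto_sqrt_atTop.comp tendsto_natCast_atTop_atTop)
  have h2 : (fun n : ℕ => (n : ℝ) ^ 2 * Real.exp (2 - κ * √(n : ℝ)))
      =O[atTop] (fun n : ℕ => (n : ℝ) ^ (-2 : ℝ)) := by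
    have h3 : (fun n : ℕ => (n : ℝ) ^ 2 * Real.exp (2 - κ * √(n : ℝ)))
        =O[atTop] (fun n : ℕ => (n : ℝ) ^ 2 * (√(n : ℝ)) ^ (-8 : ℝ)) := by
      refine (Asymptotics.isBigO_refl _ _).mul ?_
      refine Asymptotics.IsBigO.trans ?_ h1.isBigO
      refine Asymptotics.IsBigO.of_bound (Real.exp 2) (Eventually.of_forall fun n => ?_)
      simp only [Function.comp, Real.norm_eq_abs, abs_of_pos (Real.exp_pos _)]
      rw [← Real.exp_add]
      exact Real.exp_le_exp.2 (le_of_eq (by ring))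
    refine h3.trans (Asymptotics.IsBigO.of_bound 1 ?_)
    filter_upwards [eventually_gt_atTop 0] with n hn
    have hn' : (0 : ℝ) < n := by exact_mod_cast hn
    refine le_of_eq ?_
    rw [one_mul]
    congr 1
    rw [Real.sqrt_eq_rpow, ← Real.rpow_mul hn'.le, ← Real.rpow_natCast, ← Real.rpow_add hn']
    norm_num
  exact summable_of_isBigO_nat (Real.summable_nat_rpow.2 (by norm_num)) h2

lemma ae_eventually_window_le (hZm : ∀ i, Measurable (Z i)) (hind : iIndepFun Z P)
    (hlaw : ∀ i, P.map (Z i) = π)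
    {g : ℝ × ℝ → ℝ} (hg : Measurable g) {c : ℝ} (hc0 : 0 < c) (hc : ∀ᵐ z ∂π, |g z| ≤ c)
    (hzero : ∀ J : Set ℝ, MeasurableSet J → ∫ z in Prod.fst ⁻¹' J, g z ∂π = 0)
    {δ : ℝ} (hδ : 0 < δ) :
    ∀ᵐ ω ∂P, ∀ᶠ n : ℕ in atTop, ∀ a < n, ∀ b < n,
      ∑ i ∈ Finset.range n, (if (Z a ω).1 ≤ (Z i ω).1 ∧ (Z i ω).1 ≤ (Z b ω).1
        then g (Z i ω) else 0)
      ≤ δ * (∑ i ∈ Finset.range n, (if (Z a ω).1 ≤ (Z i ω).1 ∧ (Z i ω).1 ≤ (Z b ω).1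
        then (1 : ℝ) else 0) + √(n : ℝ)) := by
  -- The first bound gives s c ≤ 1, as the exponential inequality requires; the second gives (s c)²
  -- N ≤ s δ N, so a violation of the claim forces the tilted sum above s δ √n.
  set s := min (1 / c) (δ / c ^ 2) with hs
  have hs0 : 0 < s := lt_min (by positivity) (by positivity)
  have hsc : s * c ≤ 1 := (le_div_iff₀ hc0).1 (min_le_left _ _)
  have hsd : s * c ^ 2 ≤ δ := (le_div_iff₀ (by positivity)).1 (min_le_right _ _)
  set bad : ℕ → Set Ω := fun n => ⋃ a ∈ Finset.range n, ⋃ b ∈ Finset.range n,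
    {ω | s * δ * √(n : ℝ) ≤ ∑ i ∈ Finset.range n,
      windowExp g s c ((Z a ω).1, (Z b ω).1) (Z i ω)} with hbad
  have hle : ∀ n, P (bad n) ≤ ENNReal.ofReal ((n : ℝ) ^ 2 * Real.exp (2 - s * δ * √(n : ℝ))) := by
    intro n
    calc P (bad n) ≤ ∑ a ∈ Finset.range n, ∑ b ∈ Finset.range n,
          ENNReal.ofReal (Real.exp (2 - s * δ * √(n : ℝ))) := by
          refine (measure_biUnion_finset_le _ _).trans (Finset.sum_le_sum fun a ha => ?_)
          refine (measure_biUnion_finset_le _ _).trans (Finset.sum_le_sum fun b hb => ?_)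
          exact measure_sum_windowExp_ge_le hZm hind hlaw hg hs0.le hsc hc hzero
            (Finset.mem_range.1 ha) (Finset.mem_range.1 hb) _
      _ = _ := by
          rw [ENNReal.ofReal_mul (by positivity)]
          simp only [Finset.sum_const, Finset.card_range, nsmul_eq_mul]
          rw [ENNReal.ofReal_pow (by positivity), ENNReal.ofReal_natCast]
          ring
  have hsum : (∑' n, P (bad n)) ≠ ⊤ :=
    ne_top_of_le_ne_top (summable_sq_mul_exp_neg_sqrt (mul_pos hs0 hδ)).tsum_ofReal_ne_top
      (ENNReal.tsum_le_tsum hle)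
  filter_upwards [ae_eventually_notMem hsum] with ω hω
  filter_upwards [hω] with n hn a ha b hb
  by_contra! hcon
  refine hn ?_
  simp only [hbad, Set.mem_iUnion, Finset.mem_range, Set.mem_ofPred_eq]
  refine ⟨a, ha, b, hb, ?_⟩
  set N := ∑ i ∈ Finset.range n, (if (Z a ω).1 ≤ (Z i ω).1 ∧ (Z i ω).1 ≤ (Z b ω).1
        then (1 : ℝ) else 0) with hN
  have hN0 : 0 ≤ N := Finset.sum_nonneg fun i _ => by split_ifs <;> norm_num
  have e : ∑ i ∈ Finset.range n, windowExp g s c ((Z a ω).1, (Z b ω).1) (Z i ω)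
      = s * ∑ i ∈ Finset.range n, (if (Z a ω).1 ≤ (Z i ω).1 ∧ (Z i ω).1 ≤ (Z b ω).1
        then g (Z i ω) else 0) - (s * c) ^ 2 * N := by
    rw [hN, Finset.mul_sum, Finset.mul_sum, ← Finset.sum_sub_distrib]
    refine Finset.sum_congr rfl fun i _ => ?_
    unfold windowExp
    split_ifs <;> simp
  rw [e]
  have h1 := mul_lt_mul_of_pos_left hcon hs0
  have h2 : (s * c) ^ 2 * N ≤ s * δ * N := by
    refine mul_le_mul_of_nonneg_right ?_ hN0
    calc (s * c) ^ 2 = s * (s * c ^ 2) := by ring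
      _ ≤ s * δ := mul_le_mul_of_nonneg_left hsd hs0.le
  nlinarith

/-- Uniform law of large numbers over the order windows of the first coordinate. -/
lemma ae_eventually_windowBound (hZm : ∀ i, Measurable (Z i)) (hind : iIndepFun Z P)
    (hlaw : ∀ i, P.map (Z i) = π)
    {g : ℝ × ℝ → ℝ} (hg : Measurable g) {c : ℝ} (hc0 : 0 < c) (hc : ∀ᵐ z ∂π, |g z| ≤ c)
    (hzero : ∀ J : Set ℝ, MeasurableSet J → ∫ z in Prod.fst ⁻¹' J, g z ∂π = 0) :
    ∀ᵐ ω ∂P, ∀ δ > 0, ∀ᶠ n : ℕ in atTop,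
      WindowBound (fun i : Fin n => (Z i ω).1) (fun i : Fin n => g (Z i ω)) δ := by
  -- Countably many δ keep the exceptional set null; the two signs of g give the absolute value.
  have h1 : ∀ᵐ ω ∂P, ∀ k : ℕ, ∀ᶠ n : ℕ in atTop,
      WindowBound (fun i : Fin n => (Z i ω).1) (fun i : Fin n => g (Z i ω)) (1 / ((k : ℝ) + 1)) := by
    rw [ae_all_iff]
    intro k
    have hk : 0 < 1 / ((k : ℝ) + 1) := by positivity
    filter_upwards [ae_eventually_window_le hZm hind hlaw hg hc0 hc hzero hk,
      ae_eventually_window_le hZm hind hlaw hg.neg hc0 (by simpa using hc)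
        (fun J hJ => by simp [integral_neg, hzero J hJ]) hk] with ω hω1 hω2
    filter_upwards [hω1, hω2] with n hn1 hn2
    intro a b
    have h1 := hn1 a a.2 b b.2
    have h2 := hn2 a a.2 b b.2
    rw [Fin.sum_univ_eq_sum_range (fun i => if (Z a ω).1 ≤ (Z i ω).1 ∧ (Z i ω).1 ≤ (Z b ω).1
      then g (Z i ω) else 0), Fin.sum_univ_eq_sum_range (fun i =>
        if (Z a ω).1 ≤ (Z i ω).1 ∧ (Z i ω).1 ≤ (Z b ω).1 then (1 : ℝ) else 0)]
    refine abs_le.2 ⟨?_, h1⟩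
    have e : ∑ i ∈ Finset.range n, (if (Z a ω).1 ≤ (Z i ω).1 ∧ (Z i ω).1 ≤ (Z b ω).1
        then (-g) (Z i ω) else 0)
        = - ∑ i ∈ Finset.range n, (if (Z a ω).1 ≤ (Z i ω).1 ∧ (Z i ω).1 ≤ (Z b ω).1
        then g (Z i ω) else 0) := by
      rw [← Finset.sum_neg_distrib]
      refine Finset.sum_congr rfl fun i _ => ?_
      split_ifs <;> simp
    rw [e] at h2
    linarith
  filter_upwards [h1] with ω hω δ hδ
  obtain ⟨k, hk⟩ := exists_nat_one_div_lt hδ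
  filter_upwards [hω k] with n hn a b
  refine (hn a b).trans (mul_le_mul_of_nonneg_right hk.le ?_)
  have : 0 ≤ ∑ i : Fin n, (if (Z a ω).1 ≤ (Z i ω).1 ∧ (Z i ω).1 ≤ (Z b ω).1
        then (1 : ℝ) else 0) := Finset.sum_nonneg fun i _ => by split_ifs <;> norm_num
  positivity

/-- By Fubini the diagonal is null for a product of two atomless laws, and there are countably many
pairs of indices. -/
lemma ae_injective_fst (hZm : ∀ i, Measurable (Z i)) (hind : iIndepFun Z P)
    (hlaw : ∀ i, P.map (Z i) = π) (hatom : ∀ t : ℝ, π (Prod.fst ⁻¹' {t}) = 0) :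
    ∀ᵐ ω ∂P, Function.Injective (fun i => (Z i ω).1) := by
  have h : ∀ᵐ ω ∂P, ∀ i j, i ≠ j → (Z i ω).1 ≠ (Z j ω).1 := by
    rw [ae_all_iff]; intro i
    rw [ae_all_iff]; intro j
    by_cases hij : i = j
    · simp [hij]
    have hD : MeasurableSet {q : (ℝ × ℝ) × (ℝ × ℝ) | q.1.1 = q.2.1} :=
      measurableSet_eq_fun (by fun_prop) (by fun_prop)
    have h0 : (π.prod π) {q : (ℝ × ℝ) × (ℝ × ℝ) | q.1.1 = q.2.1} = 0 := by
      rw [Measure.measure_prod_null hD]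
      refine Eventually.of_forall fun z => ?_
      have : Prod.mk z ⁻¹' {q : (ℝ × ℝ) × (ℝ × ℝ) | q.1.1 = q.2.1} = Prod.fst ⁻¹' {z.1} := by
        ext w; simp [eq_comm]
      simp [this, hatom]
    have h1 := (indepFun_iff_map_prod_eq_prod_map_map (hZm i).aemeasurable
      (hZm j).aemeasurable).1 (hind.indepFun hij)
    rw [hlaw, hlaw] at h1
    rw [← h1, Measure.map_apply ((hZm i).prodMk (hZm j)) hD] at h0
    have h2 : ∀ᵐ ω ∂P, ¬ ((Z i ω).1 = (Z j ω).1) := by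
      rw [ae_iff]
      simpa using h0
    exact h2.mono fun ω hω _ => hω
  exact h.mono fun ω hω i j hij => by_contra fun hne => hω i j hne hij

end Sample

/-! ### Population side: continuous approximation of the conditional moments -/

/-- The excess of the tangent at φ over log v is at most φ/v + v/φ - 2 = (v - φ)²/(vφ). Bounding one
factor |v - φ| by A leaves a linear error, so approximation in L¹ is enough. -/
lemma log_sub_one_add_div_le {v φ v₀ A : ℝ} (hv₀ : 0 < v₀) (hv : v₀ ≤ v) (hφ : v₀ ≤ φ)
    (hvA : v ≤ A) (hφA : φ ≤ A) :
    Real.log φ - 1 + v / φ ≤ Real.log v + A / v₀ ^ 2 * |v - φ| := by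
  have hv' : 0 < v := hv₀.trans_le hv
  have hφ' : 0 < φ := hv₀.trans_le hφ
  have h1 := Real.log_le_sub_one_of_pos (div_pos hφ' hv')
  rw [Real.log_div hφ'.ne' hv'.ne'] at h1
  have h2 : φ / v + v / φ - 2 = (v - φ) ^ 2 / (v * φ) := by field_simp; ring
  have h3 : (v - φ) ^ 2 ≤ A * |v - φ| := by
    rw [← sq_abs, sq]
    refine mul_le_mul_of_nonneg_right ?_ (abs_nonneg _)
    rw [abs_le]; constructor <;> linarith
  have h4 : v₀ ^ 2 ≤ v * φ := by nlinarith
  have h5 : (v - φ) ^ 2 / (v * φ) ≤ A * |v - φ| / v₀ ^ 2 :=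
    div_le_div₀ ((sq_nonneg _).trans h3) h3 (by positivity) h4
  rw [div_mul_eq_mul_div]
  linarith

lemma abs_sub_clip_le {a b v g : ℝ} (ha : a ≤ v) (hb : v ≤ b) :
    |v - max a (min b g)| ≤ |v - g| := by
  have hab : a ≤ b := ha.trans hb
  rcases le_total b g with h | h
  · rw [min_eq_left h, max_eq_right hab, abs_of_nonpos (by linarith), abs_of_nonpos (by linarith)]
    linarith
  · rw [min_eq_right h]
    rcases le_total a g with h' | h'
    · rw [max_eq_right h']
    · rw [max_eq_left h', abs_of_nonneg (by linarith), abs_of_nonneg (by linarith)]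
      linarith

lemma integrable_log_of_bounds {Ω : Type*} [MeasurableSpace Ω] {P : Measure Ω}
    [IsProbabilityMeasure P] {f : Ω → ℝ} (hf : Measurable f) {a b : ℝ} (ha : 0 < a)
    (hfa : ∀ᵐ ω ∂P, a ≤ f ω) (hfb : ∀ᵐ ω ∂P, f ω ≤ b) :
    Integrable (fun ω => Real.log (f ω)) P := by
  refine Integrable.of_bound hf.log.aestronglyMeasurable
    (max (Real.log b) (-Real.log a)) ?_
  filter_upwards [hfa, hfb] with ω h1 h2
  have a1 := Real.log_le_log ha h1
  have a2 := Real.log_le_log (ha.trans_le h1) h2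
  rw [Real.norm_eq_abs, abs_le]
  constructor
  · linarith [le_max_right (Real.log b) (-Real.log a)]
  · linarith [le_max_left (Real.log b) (-Real.log a)]

lemma integral_add_add {Ω : Type*} [MeasurableSpace Ω] {P : Measure Ω} {f g k : Ω → ℝ}
    (hf : Integrable f P) (hg : Integrable g P) (hk : Integrable k P) :
    ∫ ω, (f ω + g ω + k ω) ∂P = ∫ ω, f ω ∂P + ∫ ω, g ω ∂P + ∫ ω, k ω ∂P := by
  have h : Integrable (fun ω => f ω + g ω) P := hf.add hg
  rw [integral_add h hk, integral_add hf hg]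

lemma integral_add_sub {Ω : Type*} [MeasurableSpace Ω] {P : Measure Ω} {f g k : Ω → ℝ}
    (hf : Integrable f P) (hg : Integrable g P) (hk : Integrable k P) :
    ∫ ω, (f ω + g ω - k ω) ∂P = ∫ ω, f ω ∂P + ∫ ω, g ω ∂P - ∫ ω, k ω ∂P := by
  have h : Integrable (fun ω => f ω + g ω) P := hf.add hg
  rw [integral_sub h hk, integral_add hf hg]

section Population

variable {Ω₀ : Type*} [MeasurableSpace Ω₀] {P₀ : Measure Ω₀}
  {X Y : Ω₀ → ℝ}

lemma IsBddContinuousRV.exists_bound (hY : IsBddContinuousRV P₀ Y) :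
    ∃ B, 0 < B ∧ ∀ᵐ ω ∂P₀, |Y ω| ≤ B := by
  obtain ⟨M, hM⟩ := hY.bounded
  exact ⟨max M 1, by positivity, hM.mono fun ω h => h.trans (le_max_left _ _)⟩

variable [IsProbabilityMeasure P₀]

lemma integral_comp_mul_eq_of_condExp (hX : Measurable X) {W : Ω₀ → ℝ} (hW : Integrable W P₀)
    {f : ℝ → ℝ} (hf : P₀[W | MeasurableSpace.comap X inferInstance] =ᵐ[P₀] fun ω => f (X ω))
    {F : ℝ → ℝ} (hF : Measurable F) {K : ℝ} (hK : ∀ᵐ ω ∂P₀, |F (X ω)| ≤ K) :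
    ∫ ω, F (X ω) * W ω ∂P₀ = ∫ ω, F (X ω) * f (X ω) ∂P₀ := by
  have hm : MeasurableSpace.comap X inferInstance ≤ ‹MeasurableSpace Ω₀› := hX.comap_le
  have hFX : StronglyMeasurable[MeasurableSpace.comap X inferInstance] (fun ω => F (X ω)) :=
    (hF.comp (comap_measurable X)).stronglyMeasurable
  have h := condExp_stronglyMeasurable_mul_of_bound hm hFX hW K hK
  have h2 := integral_condExp (μ := P₀) hm (f := (fun ω => F (X ω)) * W)
  have h3 : ∫ ω, F (X ω) * W ω ∂P₀ = ∫ ω, ((fun ω => F (X ω)) * W) ω ∂P₀ := rfl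
  rw [h3, ← h2]
  refine integral_congr_ae ?_
  filter_upwards [h, hf] with ω h1 h2
  rw [h1, Pi.mul_apply, h2]

lemma memLp_of_abs_le (hY : Measurable Y) {B : ℝ} (hB : ∀ᵐ ω ∂P₀, |Y ω| ≤ B) (p : ENNReal) :
    MemLp Y p P₀ :=
  MemLp.of_bound hY.aestronglyMeasurable B hB

lemma condExp_sq_eq {mean var : ℝ → ℝ} (hX : Measurable X) (h : IsCondMeanVar P₀ X Y mean var)
    (hY : MemLp Y 2 P₀) :
    P₀[Y ^ 2 | MeasurableSpace.comap X inferInstance]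
      =ᵐ[P₀] fun ω => mean (X ω) ^ 2 + var (X ω) := by
  filter_upwards [condVar_ae_eq_condExp_sq_sub_sq_condExp hX.comap_le hY, h.mean_eq, h.var_eq]
    with ω h1 h2 h3
  rw [h3] at h1
  simp only [Pi.sub_apply, Pi.pow_apply] at h1
  rw [h2] at h1
  linarith

lemma cond_mean_var_bounds {mean var : ℝ → ℝ} (hX : Measurable X)
    (h : IsCondMeanVar P₀ X Y mean var) (hYm : Measurable Y) {B : ℝ}
    (hYB : ∀ᵐ ω ∂P₀, |Y ω| ≤ B) :
    ∀ᵐ ω ∂P₀, |mean (X ω)| ≤ B ∧ |mean (X ω) ^ 2 + var (X ω)| ≤ B ^ 2 := by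
  have h2 : ∀ᵐ ω ∂P₀, |(Y ^ 2) ω| ≤ B ^ 2 := hYB.mono fun ω hω => by
    rw [Pi.pow_apply, abs_pow]
    exact pow_le_pow_left₀ (abs_nonneg _) hω 2
  filter_upwards [h.mean_eq, condExp_sq_eq hX h (memLp_of_abs_le hYm hYB 2),
    ae_bdd_abs_condExp_of_ae_bdd_abs hYB (m := MeasurableSpace.comap X inferInstance),
    ae_bdd_abs_condExp_of_ae_bdd_abs h2 (m := MeasurableSpace.comap X inferInstance)]
    with ω e1 e2 b1 b2
  rw [e1] at b1
  rw [e2] at b2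
  exact ⟨b1, b2⟩

/-- The defining property of the conditional expectation, transported to the joint law; with ψ the
identity and the square it supplies the centring hypothesis of the window bounds. -/
lemma setIntegral_law_eq_zero (hX : Measurable X) (hY : Measurable Y) {ψ : ℝ → ℝ} {f : ℝ → ℝ}
    (hψ : Measurable ψ) (hf : Measurable f) (hint : Integrable (fun ω => ψ (Y ω)) P₀)
    (hfint : Integrable (fun ω => f (X ω)) P₀)
    (h : P₀[fun ω => ψ (Y ω) | MeasurableSpace.comap X inferInstance] =ᵐ[P₀] fun ω => f (X ω))
    (J : Set ℝ) (hJ : MeasurableSet J) :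
    ∫ z in Prod.fst ⁻¹' J, (ψ z.2 - f z.1) ∂(P₀.map fun ω => (X ω, Y ω)) = 0 := by
  have hXY : Measurable fun ω => (X ω, Y ω) := hX.prodMk hY
  have hm : Measurable fun z : ℝ × ℝ => ψ z.2 - f z.1 :=
    (hψ.comp measurable_snd).sub (hf.comp measurable_fst)
  rw [setIntegral_map (measurable_fst hJ) hm.aestronglyMeasurable hXY.aemeasurable]
  have e : (fun ω => (X ω, Y ω)) ⁻¹' (Prod.fst ⁻¹' J) = X ⁻¹' J := rfl
  rw [e]
  change ∫ ω in X ⁻¹' J, (ψ (Y ω) - f (X ω)) ∂P₀ = 0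
  rw [integral_sub hint.integrableOn hfint.integrableOn,
    ← setIntegral_condExp hX.comap_le hint ⟨J, hJ, rfl⟩,
    setIntegral_congr_ae (hX hJ) (h.mono fun ω hω _ => hω), sub_self]

/-- By the law of total variance, var(Y) is at least the mean conditional variance. -/
lemma variance_pos_of_condVar (hX : Measurable X) (hY : MemLp Y 2 P₀) {var : ℝ → ℝ}
    (h : Var[Y; P₀ | MeasurableSpace.comap X inferInstance] =ᵐ[P₀] fun ω => var (X ω)) {v₀ : ℝ}
    (hv₀ : 0 < v₀) (hv : ∀ᵐ ω ∂P₀, v₀ ≤ var (X ω)) : 0 < Var[Y; P₀] := by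
  rw [← integral_condVar_add_variance_condExp hX.comap_le hY]
  have h1 : v₀ ≤ ∫ ω, (Var[Y; P₀ | MeasurableSpace.comap X inferInstance]) ω ∂P₀ := by
    calc v₀ = ∫ _ω, v₀ ∂P₀ := by simp
      _ ≤ _ := integral_mono_ae (integrable_const _) integrable_condVar (by
          filter_upwards [h, hv] with ω e hω
          rwa [e])
  have h2 := variance_nonneg (P₀[Y | MeasurableSpace.comap X inferInstance]) P₀
  linarith

/-- The conditional mean and variance can be replaced by continuous functions in the linearized
logarithm at an arbitrarily small cost. -/
lemma exists_continuous_integral_logLin_le (hX : Measurable X) (hY : Measurable Y)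
    {mean var : ℝ → ℝ} (h : IsCondMeanVar P₀ X Y mean var) {M B v₀ : ℝ}
    (hXM : ∀ᵐ ω ∂P₀, |X ω| ≤ M) (hB : 0 < B) (hYB : ∀ᵐ ω ∂P₀, |Y ω| ≤ B) (hv₀ : 0 < v₀)
    (hv : ∀ᵐ ω ∂P₀, v₀ ≤ var (X ω)) {η : ℝ} (hη : 0 < η) :
    ∃ φ c : ℝ → ℝ, Continuous φ ∧ Continuous c ∧ (∀ u, 0 < φ u) ∧
      ∫ ω, logLin φ c (X ω) (Y ω) ∂P₀ ≤ ∫ ω, Real.log (var (X ω)) ∂P₀ + η := by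
  have hbd := cond_mean_var_bounds hX h hY hYB
  -- B² already bounds the conditional variance; adding v₀ ensures v₀ ≤ A, so that clipping to [v₀,
  -- A] makes sense.
  set A := B ^ 2 + v₀ with hA
  have hApos : 0 < A := by positivity
  have hvA : ∀ᵐ ω ∂P₀, var (X ω) ≤ A := by
    filter_upwards [hbd] with ω hω
    have := (abs_le.1 hω.2).2
    nlinarith [sq_nonneg (mean (X ω))]
  have hvabs : ∀ᵐ ω ∂P₀, |var (X ω)| ≤ A := by
    filter_upwards [hvA, hv] with ω h1 h2
    exact abs_le.2 ⟨by linarith, h1⟩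
  have hvi : Integrable (fun ω => var (X ω)) P₀ :=
    Integrable.of_bound (h.measurable_var.comp hX).aestronglyMeasurable A hvabs
  have hmi : Integrable (fun ω => mean (X ω)) P₀ :=
    Integrable.of_bound (h.measurable_mean.comp hX).aestronglyMeasurable B (hbd.mono fun _ h => h.1)
  have hρ : IsProbabilityMeasure (P₀.map X) := Measure.isProbabilityMeasure_map hX.aemeasurable
  have hviρ : Integrable var (P₀.map X) :=
    (integrable_map_measure h.measurable_var.aestronglyMeasurable hX.aemeasurable).2 hvi
  have hmiρ : Integrable mean (P₀.map X) :=
    (integrable_map_measure h.measurable_mean.aestronglyMeasurable hX.aemeasurable).2 hmi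
  -- Each tolerance is half of η divided by the factor with which that L¹ error enters the final
  -- estimate.
  set η₁ := η / 2 / (A / v₀ ^ 2) with hη₁
  set η₂ := η / 2 / (2 * B / v₀) with hη₂
  obtain ⟨g₁, hg₁, hg₁i⟩ := hviρ.exists_boundedContinuous_integral_sub_le
    (show 0 < η₁ by positivity)
  obtain ⟨g₂, hg₂, hg₂i⟩ := hmiρ.exists_boundedContinuous_integral_sub_le
    (show 0 < η₂ by positivity)
  have hm₁ : Measurable fun u => ‖var u - g₁ u‖ :=
    (h.measurable_var.sub g₁.continuous.measurable).norm
  have hm₂ : Measurable fun u => ‖mean u - g₂ u‖ :=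
    (h.measurable_mean.sub g₂.continuous.measurable).norm
  rw [integral_map hX.aemeasurable hm₁.aestronglyMeasurable] at hg₁
  rw [integral_map hX.aemeasurable hm₂.aestronglyMeasurable] at hg₂
  have hg₁i' : Integrable (fun ω => |var (X ω) - g₁ (X ω)|) P₀ :=
    (hvi.sub (hg₁i.comp_measurable hX)).abs
  have hg₂i' : Integrable (fun ω => |mean (X ω) - g₂ (X ω)|) P₀ :=
    (hmi.sub (hg₂i.comp_measurable hX)).abs
  -- Clipping keeps φ away from zero and both functions bounded, without increasing the distance to
  -- the conditional moments.
  set φ : ℝ → ℝ := fun u => max v₀ (min A (g₁ u)) with hφ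
  set c : ℝ → ℝ := fun u => max (-B) (min B (g₂ u)) with hc
  have hφc : Continuous φ := continuous_const.max (continuous_const.min g₁.continuous)
  have hcc : Continuous c := continuous_const.max (continuous_const.min g₂.continuous)
  have hφv : ∀ u, v₀ ≤ φ u := fun u => le_max_left _ _
  have hφA : ∀ u, φ u ≤ A := fun u => max_le (by rw [hA]; nlinarith [sq_nonneg B]) (min_le_left _ _)
  have hφ0 : ∀ u, 0 < φ u := fun u => hv₀.trans_le (hφv u)
  refine ⟨φ, c, hφc, hcc, hφ0, ?_⟩
  have hbF : ∀ {F : ℝ → ℝ}, Continuous F → ∃ K, ∀ᵐ ω ∂P₀, |F (X ω)| ≤ K := by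
    intro F hF
    obtain ⟨K, hK⟩ := (isCompact_Icc (a := -M) (b := M)).exists_bound_of_continuousOn
      hF.continuousOn
    exact ⟨K, hXM.mono fun ω hω => hK _ (abs_le.1 hω)⟩
  have hφ' : ∀ u, φ u ≠ 0 := fun u => (hφ0 u).ne'
  have hF0 : Continuous (fun u => Real.log (φ u) - 1 + c u ^ 2 / φ u) :=
    ((hφc.log hφ').sub continuous_const).add ((hcc.pow 2).div hφc hφ')
  have hF1 : Continuous (fun u => 2 * c u / φ u) := (continuous_const.mul hcc).div hφc hφ'
  have hF2 : Continuous (fun u => 1 / φ u) := continuous_const.div hφc hφ'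
  obtain ⟨K0, hK0⟩ := hbF hF0
  obtain ⟨K1, hK1⟩ := hbF hF1
  obtain ⟨K2, hK2⟩ := hbF hF2
  have hYi : Integrable Y P₀ := (memLp_of_abs_le hY hYB 1).integrable le_rfl
  have hY2i : Integrable (Y ^ 2) P₀ := (memLp_of_abs_le hY hYB 2).integrable_sq
  have hqi : Integrable (fun ω => mean (X ω) ^ 2 + var (X ω)) P₀ :=
    Integrable.of_bound (((h.measurable_mean.comp hX).pow_const 2).add
      (h.measurable_var.comp hX)).aestronglyMeasurable (B ^ 2) (hbd.mono fun _ h => h.2)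
  have i0 : Integrable (fun ω => Real.log (φ (X ω)) - 1 + c (X ω) ^ 2 / φ (X ω)) P₀ :=
    Integrable.of_bound (hF0.measurable.comp hX).aestronglyMeasurable K0 hK0
  have iF : ∀ {F : ℝ → ℝ} {W : Ω₀ → ℝ}, Continuous F → Integrable W P₀ → (∃ K, ∀ᵐ ω ∂P₀, |F (X ω)| ≤ K) →
      Integrable (fun ω => F (X ω) * W ω) P₀ := by
    rintro F W hF hW ⟨K, hK⟩
    exact hW.bdd_mul (hF.measurable.comp hX).aestronglyMeasurable hK
  have i1 := iF hF1 hYi ⟨K1, hK1⟩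
  have i2 := iF hF2 hY2i ⟨K2, hK2⟩
  have j1 := iF hF1 hmi ⟨K1, hK1⟩
  have j2 := iF hF2 hqi ⟨K2, hK2⟩
  have e1 := integral_comp_mul_eq_of_condExp hX hYi h.mean_eq hF1.measurable hK1
  have e2 := integral_comp_mul_eq_of_condExp hX hY2i
    (f := fun u => mean u ^ 2 + var u)
    (condExp_sq_eq hX h (memLp_of_abs_le hY hYB 2)) hF2.measurable hK2
  have hlogi : Integrable (fun ω => Real.log (var (X ω))) P₀ :=
    integrable_log_of_bounds (h.measurable_var.comp hX) hv₀ hv hvA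
  calc ∫ ω, logLin φ c (X ω) (Y ω) ∂P₀
      = ∫ ω, ((Real.log (φ (X ω)) - 1 + c (X ω) ^ 2 / φ (X ω))
          + 1 / φ (X ω) * (Y ^ 2) ω - 2 * c (X ω) / φ (X ω) * Y ω) ∂P₀ := by
        refine integral_congr_ae (Eventually.of_forall fun ω => ?_)
        simp only [logLin, Pi.pow_apply]
        ring
    _ = ∫ ω, ((Real.log (φ (X ω)) - 1 + c (X ω) ^ 2 / φ (X ω))
          + 1 / φ (X ω) * (mean (X ω) ^ 2 + var (X ω))
          - 2 * c (X ω) / φ (X ω) * mean (X ω)) ∂P₀ := by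
        rw [integral_add_sub i0 i2 i1, integral_add_sub i0 j2 j1, e1, e2]
    _ ≤ ∫ ω, (Real.log (var (X ω)) + A / v₀ ^ 2 * |var (X ω) - g₁ (X ω)|
          + 2 * B / v₀ * |mean (X ω) - g₂ (X ω)|) ∂P₀ := by
        refine integral_mono_ae ((i0.add j2).sub j1)
          ((hlogi.add (hg₁i'.const_mul _)).add (hg₂i'.const_mul _)) ?_
        filter_upwards [hbd, hv, hvA] with ω hω h1 h2
        have a1 := log_sub_one_add_div_le hv₀ h1 (hφv (X ω)) h2 (hφA (X ω))
        have a2 : |var (X ω) - φ (X ω)| ≤ |var (X ω) - g₁ (X ω)| := abs_sub_clip_le h1 h2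
        have a3 : |mean (X ω) - c (X ω)| ≤ |mean (X ω) - g₂ (X ω)| :=
          abs_sub_clip_le (abs_le.1 hω.1).1 (abs_le.1 hω.1).2
        have a4 : |c (X ω)| ≤ B := abs_clip_le hB.le
        have a5 : (mean (X ω) - c (X ω)) ^ 2 / φ (X ω)
            ≤ 2 * B / v₀ * |mean (X ω) - g₂ (X ω)| := by
          rw [div_mul_eq_mul_div]
          refine div_le_div₀ (by positivity) ?_ hv₀ (hφv _)
          rw [← sq_abs, sq]
          refine mul_le_mul ?_ a3 (abs_nonneg _) (by positivity)
          linarith [abs_sub (mean (X ω)) (c (X ω)), hω.1]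
        have a6 : A / v₀ ^ 2 * |var (X ω) - φ (X ω)| ≤ A / v₀ ^ 2 * |var (X ω) - g₁ (X ω)| :=
          mul_le_mul_of_nonneg_left a2 (by positivity)
        -- Bias-variance decomposition: the conditional mean of (Y - c)² is var + (mean - c)².
        have a7 : (Real.log (φ (X ω)) - 1 + c (X ω) ^ 2 / φ (X ω))
          + 1 / φ (X ω) * (mean (X ω) ^ 2 + var (X ω))
          - 2 * c (X ω) / φ (X ω) * mean (X ω)
          = Real.log (φ (X ω)) - 1 + var (X ω) / φ (X ω)
            + (mean (X ω) - c (X ω)) ^ 2 / φ (X ω) := by ring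
        change (Real.log (φ (X ω)) - 1 + c (X ω) ^ 2 / φ (X ω))
          + 1 / φ (X ω) * (mean (X ω) ^ 2 + var (X ω))
          - 2 * c (X ω) / φ (X ω) * mean (X ω) ≤ Real.log (var (X ω))
            + A / v₀ ^ 2 * |var (X ω) - g₁ (X ω)| + 2 * B / v₀ * |mean (X ω) - g₂ (X ω)|
        rw [a7]
        linarith
    _ = ∫ ω, Real.log (var (X ω)) ∂P₀ + A / v₀ ^ 2 * ∫ ω, |var (X ω) - g₁ (X ω)| ∂P₀
          + 2 * B / v₀ * ∫ ω, |mean (X ω) - g₂ (X ω)| ∂P₀ := by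
        rw [integral_add_add hlogi (hg₁i'.const_mul _) (hg₂i'.const_mul _),
          integral_const_mul, integral_const_mul]
    _ ≤ ∫ ω, Real.log (var (X ω)) ∂P₀ + A / v₀ ^ 2 * η₁ + 2 * B / v₀ * η₂ := by
        have b1 := mul_le_mul_of_nonneg_left hg₁ (show 0 ≤ A / v₀ ^ 2 by positivity)
        have b2 := mul_le_mul_of_nonneg_left hg₂ (show 0 ≤ 2 * B / v₀ by positivity)
        simp only [Real.norm_eq_abs] at b1 b2
        linarith
    _ = _ := by
        rw [hη₁, hη₂, mul_div_cancel₀ _ (by positivity), mul_div_cancel₀ _ (by positivity)]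
        ring

end Population

/-! ### Almost sure limits and conclusion -/

lemma sampleVar_eq {n : ℕ} (hn : 0 < n) (y : Fin n → ℝ) :
    sampleVar y = (∑ i, y i ^ 2) / n - ((∑ i, y i) / n) ^ 2 := by
  have hn' : (n : ℝ) ≠ 0 := by positivity
  rw [sampleVar]
  simp only [sub_sq, Finset.sum_add_distrib, Finset.sum_sub_distrib, ← Finset.mul_sum,
    ← Finset.sum_mul, Finset.sum_const, Finset.card_univ, Fintype.card_fin, nsmul_eq_mul]
  field_simp
  ring

/-- Almost surely, the maximal likelihood ratio has the population rate. Of the regularity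
conditions only the lower bound for the conditional variance is needed. -/
lemma ae_maxLRLimit {Ω₀ : Type*} [MeasurableSpace Ω₀] {P₀ : Measure Ω₀} [IsProbabilityMeasure P₀]
    {X Y : Ω₀ → ℝ} (hX : IsBddContinuousRV P₀ X) (hY : IsBddContinuousRV P₀ Y)
    {mean var : ℝ → ℝ} (h : IsCondMeanVar P₀ X Y mean var)
    {v₀ : ℝ} (hv₀ : 0 < v₀) (hv : ∀ᵐ ω ∂P₀, v₀ ≤ var (X ω))
    {Ω : Type*} [MeasurableSpace Ω] {P : Measure Ω} [IsProbabilityMeasure P]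
    {Z : ℕ → Ω → ℝ × ℝ} (hZm : ∀ i, Measurable (Z i)) (hind : iIndepFun Z P)
    (hlaw : ∀ i, P.map (Z i) = P₀.map fun ω => (X ω, Y ω)) :
    ∀ᵐ ω ∂P, MaxLRLimit (fun i => (Z i ω).1) (fun i => (Z i ω).2)
      (Real.log (Var[Y; P₀])
        - ∫ ω, Real.log ((Var[Y; P₀ | MeasurableSpace.comap X inferInstance]) ω) ∂P₀) := by
  have hXm := hX.measurable
  have hYm := hY.measurable
  obtain ⟨M, hM, hXM⟩ := hX.exists_bound
  obtain ⟨B, hB, hYB⟩ := hY.exists_bound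
  have hXY : Measurable fun ω => (X ω, Y ω) := hXm.prodMk hYm
  set π := P₀.map fun ω => (X ω, Y ω) with hπ
  have hπp : IsProbabilityMeasure π := Measure.isProbabilityMeasure_map hXY.aemeasurable
  have hY2 := memLp_of_abs_le hYm hYB 2
  have hbd := cond_mean_var_bounds hXm h hYm hYB
  have hvB : ∀ᵐ ω ∂P₀, var (X ω) ≤ B ^ 2 := by
    filter_upwards [hbd] with ω hω
    have := (abs_le.1 hω.2).2
    nlinarith [sq_nonneg (mean (X ω))]
  have hΛeq : ∫ ω, Real.log ((Var[Y; P₀ | MeasurableSpace.comap X inferInstance]) ω) ∂P₀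
      = ∫ ω, Real.log (var (X ω)) ∂P₀ :=
    integral_congr_ae (h.var_eq.mono fun ω hω => by simp only [hω])
  rw [hΛeq]
  have toπ : ∀ {p : ℝ × ℝ → Prop}, MeasurableSet {z | p z} → (∀ᵐ ω ∂P₀, p (X ω, Y ω)) →
      ∀ᵐ z ∂π, p z := fun hp hω => (ae_map_iff hXY.aemeasurable hp).2 hω
  have intπ : ∀ {f : ℝ × ℝ → ℝ}, Measurable f → ∫ z, f z ∂π = ∫ ω, f (X ω, Y ω) ∂P₀ :=
    fun hf => integral_map hXY.aemeasurable hf.aestronglyMeasurable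
  have hvar1 : Measurable fun z : ℝ × ℝ => var z.1 := h.measurable_var.comp measurable_fst
  have hmean1 : Measurable fun z : ℝ × ℝ => mean z.1 := h.measurable_mean.comp measurable_fst
  have hXMπ : ∀ᵐ z ∂π, |z.1| ≤ M := toπ (measurableSet_le (by fun_prop) (by fun_prop)) hXM
  have hYBπ : ∀ᵐ z ∂π, |z.2| ≤ B := toπ (measurableSet_le (by fun_prop) (by fun_prop)) hYB
  have hvπ : ∀ᵐ z ∂π, v₀ ≤ var z.1 := toπ (measurableSet_le (by fun_prop) hvar1) hv
  have hvBπ : ∀ᵐ z ∂π, var z.1 ≤ B ^ 2 := toπ (measurableSet_le hvar1 (by fun_prop)) hvB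
  have hmπ : ∀ᵐ z ∂π, |mean z.1| ≤ B :=
    toπ (measurableSet_le hmean1.abs (by fun_prop)) (hbd.mono fun _ h => h.1)
  have hqπ : ∀ᵐ z ∂π, |mean z.1 ^ 2 + var z.1| ≤ B ^ 2 :=
    toπ (measurableSet_le ((hmean1.pow_const 2).add hvar1).abs (by fun_prop))
      (hbd.mono fun _ h => h.2)
  have hinj := ae_injective_fst hZm hind hlaw (fun t => by
    rw [hπ, Measure.map_apply hXY (measurable_fst (measurableSet_singleton t))]
    exact hX.noAtoms t)
  have hwm := ae_eventually_windowBound hZm hind hlaw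
    (g := fun z => z.2 - mean z.1) (measurable_snd.sub hmean1) (c := 2 * B) (by positivity)
    (by
      filter_upwards [hYBπ, hmπ] with z h1 h2
      linarith [abs_sub z.2 (mean z.1)])
    (setIntegral_law_eq_zero hXm hYm measurable_id h.measurable_mean
      (hY2.integrable one_le_two)
      (Integrable.of_bound (h.measurable_mean.comp hXm).aestronglyMeasurable B
        (hbd.mono fun _ h => h.1)) h.mean_eq)
  have hwq := ae_eventually_windowBound hZm hind hlaw
    (g := fun z => z.2 ^ 2 - (mean z.1 ^ 2 + var z.1))
    ((measurable_snd.pow_const 2).sub ((hmean1.pow_const 2).add hvar1))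
    (c := 2 * B ^ 2) (by positivity)
    (by
      filter_upwards [hYBπ, hqπ] with z h1 h2
      have h3 : |z.2 ^ 2| ≤ B ^ 2 := by
        rw [abs_pow]
        exact pow_le_pow_left₀ (abs_nonneg _) h1 2
      linarith [abs_sub (z.2 ^ 2) (mean z.1 ^ 2 + var z.1)])
    (setIntegral_law_eq_zero hXm hYm (measurable_id.pow_const 2)
      ((h.measurable_mean.pow_const 2).add h.measurable_var)
      hY2.integrable_sq
      (Integrable.of_bound (((h.measurable_mean.pow_const 2).add
        h.measurable_var).comp hXm).aestronglyMeasurable (B ^ 2)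
        (hbd.mono fun _ h => h.2)) (condExp_sq_eq hXm h hY2))
  have hl1 := ae_tendsto_average hZm hind hlaw (f := fun z => z.2) measurable_snd
    (Integrable.of_bound measurable_snd.aestronglyMeasurable B hYBπ)
  have hl2 := ae_tendsto_average hZm hind hlaw (f := fun z => z.2 ^ 2)
    (measurable_snd.pow_const 2)
    (Integrable.of_bound (measurable_snd.pow_const 2).aestronglyMeasurable (B ^ 2)
      (hYBπ.mono fun z hz => by
        rw [Real.norm_eq_abs, abs_pow]
        exact pow_le_pow_left₀ (abs_nonneg _) hz 2))
  have hlΛ := ae_tendsto_average hZm hind hlaw (f := fun z => Real.log (var z.1)) hvar1.log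
    (integrable_log_of_bounds hvar1 hv₀ hvπ hvBπ)
  rw [intπ measurable_snd] at hl1
  rw [intπ (measurable_snd.pow_const 2)] at hl2
  rw [intπ hvar1.log] at hlΛ
  set Λ := ∫ ω, Real.log (var (X ω)) ∂P₀ with hΛ
  -- The functions φ and c, and with them the null set of the strong law, depend on the tolerance;
  -- hence only the countably many values 1 / (k + 1).
  have hlin : ∀ᵐ ω ∂P, ∀ k : ℕ, ∃ φ c : ℝ → ℝ, Continuous φ ∧ Continuous c ∧ (∀ u, 0 < φ u) ∧
      ∀ᶠ n : ℕ in atTop, (∑ i ∈ Finset.range n, logLin φ c (Z i ω).1 (Z i ω).2) / n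
        ≤ Λ + 1 / ((k : ℝ) + 1) := by
    rw [ae_all_iff]
    intro k
    have hk : 0 < 1 / ((k : ℝ) + 1) := by positivity
    obtain ⟨φ, c, hφ, hc, hφ0, hle⟩ := exists_continuous_integral_logLin_le hXm hYm h hXM hB hYB
      hv₀ hv (half_pos hk)
    have hcont : Continuous fun z : ℝ × ℝ => logLin φ c z.1 z.2 := by
      have h1 := hφ.comp (continuous_fst (X := ℝ) (Y := ℝ))
      have h2 := hc.comp (continuous_fst (X := ℝ) (Y := ℝ))
      exact ((h1.log fun z => (hφ0 z.1).ne').sub continuous_const).add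
        (((continuous_snd.sub h2).pow 2).div h1 fun z => (hφ0 z.1).ne')
    obtain ⟨K, hK⟩ := ((isCompact_Icc (a := -M) (b := M)).prod
      (isCompact_Icc (a := -B) (b := B))).exists_bound_of_continuousOn hcont.continuousOn
    have hl := ae_tendsto_average hZm hind hlaw hcont.measurable
      (Integrable.of_bound hcont.measurable.aestronglyMeasurable K (by
        filter_upwards [hXMπ, hYBπ] with z h1 h2
        exact hK z ⟨abs_le.1 h1, abs_le.1 h2⟩))
    rw [intπ hcont.measurable] at hl
    filter_upwards [hl] with ω hω
    refine ⟨φ, c, hφ, hc, hφ0, ?_⟩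
    have hlt : ∫ ω, logLin φ c (X ω) (Y ω) ∂P₀ < Λ + 1 / ((k : ℝ) + 1) := by linarith
    filter_upwards [hω.eventually_lt_const hlt] with n hn
    exact hn.le
  filter_upwards [hinj, hwm, hwq, hl1, hl2, hlΛ, hlin, ae_law hZm hlaw hXMπ,
    ae_law hZm hlaw hYBπ, ae_law hZm hlaw hvπ] with ω w1 w2 w3 w4 w5 w6 w7 w8 w9 w10
  refine maxLRLimit_of_window (m := mean) (v := var) w1 w8 w9 hv₀ w10 w2 w3
    (variance_pos_of_condVar hXm hY2 h.var_eq hv₀ hv) ?_ w6 ?_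
  · rw [variance_eq_sub hY2]
    refine (w5.sub (w4.pow 2)).congr' ?_
    filter_upwards [eventually_gt_atTop 0] with n hn
    rw [sampleVar_eq hn, Fin.sum_univ_eq_sum_range (fun i => (Z i ω).2 ^ 2),
      Fin.sum_univ_eq_sum_range (fun i => (Z i ω).2)]
  · intro η hη
    obtain ⟨k, hk⟩ := exists_nat_one_div_lt hη
    obtain ⟨φ, c, hφ, hc, hφ0, hn⟩ := w7 k
    exact ⟨φ, c, hφ, hc, hφ0, hn.mono fun n hn => hn.trans (by linarith)⟩

lemma popGsqCond_eq {Ω₀ : Type*} [MeasurableSpace Ω₀] (P₀ : Measure Ω₀) (X Y : Ω₀ → ℝ) :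
    popGsqCond P₀ X Y = 1 - Real.exp (-(Real.log (Var[Y; P₀])
        - ∫ ω, Real.log ((Var[Y; P₀ | MeasurableSpace.comap X inferInstance]) ω) ∂P₀)) := by
  rw [popGsqCond, neg_sub]

theorem theorem1
    {Ω₀ : Type*} [MeasurableSpace Ω₀] (P₀ : Measure Ω₀) [IsProbabilityMeasure P₀]
    (X Y : Ω₀ → ℝ)
    (hX : IsBddContinuousRV P₀ X) (hY : IsBddContinuousRV P₀ Y)
    (meanY varY meanX varX : ℝ → ℝ)
    (hYX : IsCondMeanVar P₀ X Y meanY varY) (hXY : IsCondMeanVar P₀ Y X meanX varX)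
    (b C : ℝ) (hb : 0 < b) (hC : 0 < C)
    (hregY : RegularCondMeanVar (P₀.map X) b C meanY varY)
    (hregX : RegularCondMeanVar (P₀.map Y) b C meanX varX)
    {Ω : Type*} [MeasurableSpace Ω] (P : Measure Ω) [IsProbabilityMeasure P]
    (Xs Ys : ℕ → Ω → ℝ)
    (hXs : ∀ i, Measurable (Xs i)) (hYs : ∀ i, Measurable (Ys i))
    (hindep : iIndepFun (fun i ω => (Xs i ω, Ys i ω)) P)
    (hident : ∀ i, IdentDistrib (fun ω => (Xs i ω, Ys i ω)) (fun ω => (X ω, Y ω)) P P₀)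
    (lam : ℝ) (hlam : 0 < lam) :
    (∀ᵐ ω ∂P, Tendsto
      (fun n : ℕ => GmCond lam (fun i : Fin n => Xs i ω) (fun i : Fin n => Ys i ω))
      atTop (𝓝 (popGsqCond P₀ X Y))) ∧
    (∀ᵐ ω ∂P, Tendsto
      (fun n : ℕ => GtCond lam (fun i : Fin n => Xs i ω) (fun i : Fin n => Ys i ω))
      atTop (𝓝 (popGsqCond P₀ X Y))) ∧
    (∀ᵐ ω ∂P, Tendsto
      (fun n : ℕ => Gm lam (fun i : Fin n => Xs i ω) (fun i : Fin n => Ys i ω))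
      atTop (𝓝 (popGsq P₀ X Y))) ∧
    (∀ᵐ ω ∂P, Tendsto
      (fun n : ℕ => Gt lam (fun i : Fin n => Xs i ω) (fun i : Fin n => Ys i ω))
      atTop (𝓝 (popGsq P₀ X Y))) := by
  have hv₀ : 0 < b⁻¹ ^ 2 := by positivity
  have h1 := ae_maxLRLimit hX hY hYX hv₀
    ((ae_of_ae_map hX.measurable.aemeasurable hregY.var_lower).mono fun _ h => h.le)
    (Z := fun i ω => (Xs i ω, Ys i ω)) (fun i => (hXs i).prodMk (hYs i)) hindep
    (fun i => (hident i).map_eq)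
  have hswap : Measurable (Prod.swap : ℝ × ℝ → ℝ × ℝ) := measurable_swap
  -- Swapping coordinates preserves independence and carries the law of (X, Y) to that of (Y, X), so
  -- the reverse regression is the same statement.
  have h2 := ae_maxLRLimit hY hX hXY hv₀
    ((ae_of_ae_map hY.measurable.aemeasurable hregX.var_lower).mono fun _ h => h.le)
    (Z := fun i ω => (Ys i ω, Xs i ω)) (fun i => (hYs i).prodMk (hXs i))
    (hindep.comp (fun _ => Prod.swap) fun _ => hswap)
    (fun i => ((hident i).comp hswap).map_eq)
  simp only [popGsq, popGsqCond_eq]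
  refine ⟨?_, ?_, ?_, ?_⟩
  · filter_upwards [h1] with ω w1
    exact w1.tendsto_GmCond hlam
  · filter_upwards [h1] with ω w1
    exact w1.tendsto_GtCond hlam
  · filter_upwards [h1, h2] with ω w1 w2
    exact (w1.tendsto_GmCond hlam).max (w2.tendsto_GmCond hlam)
  · filter_upwards [h1, h2] with ω w1 w2
    exact (w1.tendsto_GtCond hlam).max (w2.tendsto_GtCond hlam)
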